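/- For positive integers $t,v,k,\lambda$, a $t$-$(v,k,\lambda)$ design consists of a $v$-set $V$ and a set $B$ of $k$-subsets of $V$ (the blocks) such that every $t$-subset of $V$ is contained in exactly $\lambda$ blocks. It is nontrivial if $B$ is not the set of all $k$-subsets of $V$, and a $2s$-$(v,k,\lambda)$ design is tight if $|B| = \binom{v}{s}$. For a natural number $n$ let $\ell_n := \operatorname{lcm}\{\binom{i}{j} : 0 \le j \le i \le n\}$, let $\pi(x)$ be the number of primes not exceeding the real number $x$, and let $\operatorname{val}_p$ be the $p$-adic valuation. Let $s$ be a natural number, $r$ an even natural number with $6 \le r \le s$, and $b$ a real number with $b \le s$. Put $$\tilde F_{s,r} := s!\, r!\, \ell_{s-1}^2\, \ell_{s-2}^2\, (s-r+1)!\, (s - r/2 + 1), \qquad \psi^b_{s,r} := r - 4 - 4\pi(b),$$ $$\kappa^b_{s,r} := 2\left( \ln \frac{(2s - 3r/2 + 2)!\, s!}{(2s-r+2)!\,(s-r+1)!\,(s-r/2+1)} + (s-r)\ln 2 \right) + 2 \sum_{\substack{p \text{ prime}\\ b < p \le s}} \operatorname{val}_p(\tilde F_{s,r}) \ln p + \left(4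 \ln \tfrac32\right)\pi(b).$$ Suppose that $\psi^b_{s,r} > 0$. If a nontrivial tight $2s$-$(v,k,\lambda)$ design exists, then $$v - 2s + 1 \le \exp\left(\kappa^b_{s,r} / \psi^b_{s,r}\right).$$ -/

import Mathlib

open scoped Nat

/-- `B` is the collection of blocks of a `t`-`(v, k, l)` design on the point set `V`, where `t`,
`v`, `k`, `l` are positive: `V` is a `v`-set, all blocks are `k`-subsets of `V` (no repeated
blocks), and every `t`-subset of `V` is contained in exactly `l` blocks. -/
structure IsDesign {V : Type*} [Fintype V] [DecidableEq V] (t v k l : ℕ)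
    (B : Finset (Finset V)) : Prop where
  t_pos : 0 < t
  v_pos : 0 < v
  k_pos : 0 < k
  l_pos : 0 < l
  card_points : Fintype.card V = v
  card_block : ∀ A ∈ B, A.card = k
  card_cover : ∀ T : Finset V, T.card = t → (B.filter (fun A => T ⊆ A)).card = l

/-- A nontrivial tight `2s`-`(v, k, l)` design: not all `k`-subsets of `V` are blocks, and the
number of blocks attains the Fisher type lower bound `v.choose s`. -/
structure IsNontrivialTightDesign {V : Type*} [Fintype V] [DecidableEq V] (s v k l : ℕ)
    (B : Finset (Finset V)) : Prop where
  isDesign : IsDesign (2 * s) v k l B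
  nontrivial : B ≠ Finset.univ.powersetCard k
  tight : B.card = v.choose s

/-- `ell n` is the least common multiple of all binomial coefficients `i.choose j` with
`0 ≤ j ≤ i ≤ n`. -/
def ell (n : ℕ) : ℕ :=
  (Finset.range (n + 1)).lcm fun i => (Finset.range (i + 1)).lcm fun j => i.choose j

/-- The integer `s! r! ℓ_{s-1}² ℓ_{s-2}² (s - r + 1)! (s - r/2 + 1)`, for `r` even with
`2 ≤ r ≤ s` (so that no subtraction or division truncates). -/
def Ftilde (s r : ℕ) : ℕ :=
  s ! * r ! * ell (s - 1) ^ 2 * ell (s - 2) ^ 2 * (s - r + 1)! * (s - r / 2 + 1)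

/-- The number of primes `p ≤ x`, for a real number `x`. -/
noncomputable def primePi (x : ℝ) : ℕ := Nat.primeCounting ⌊x⌋₊

/-- The primes in the interval `(b, s]`. -/
noncomputable def primesIoc (b : ℝ) (s : ℕ) : Finset ℕ :=
  (Finset.range (s + 1)).filter fun p => p.Prime ∧ b < (p : ℝ)

/-- `ψ = r - 4 - 4 π(b)`, as a real number. -/
noncomputable def psi (r : ℕ) (b : ℝ) : ℝ := (r : ℝ) - 4 - 4 * (primePi b : ℝ)

/-- The quantity `κ`, for `r` even with `r ≤ s` (so that no subtraction or division of natural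
numbers truncates). -/
noncomputable def kappa (s r : ℕ) (b : ℝ) : ℝ :=
  2 * (Real.log
        ((((2 * s - 3 * r / 2 + 2)! : ℕ) : ℝ) * ((s ! : ℕ) : ℝ) /
          ((((2 * s - r + 2)! : ℕ) : ℝ) * (((s - r + 1)! : ℕ) : ℝ) * ((s - r / 2 + 1 : ℕ) : ℝ)))
      + ((s : ℝ) - (r : ℝ)) * Real.log 2)
  + 2 * (∑ p ∈ primesIoc b s, (padicValNat p (Ftilde s r) : ℝ) * Real.log (p : ℝ))
  + 4 * Real.log (3 / 2) * (primePi b : ℝ)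

/-!
Write `K = k - s`, `L = v - k - s` and `n = K + L + 1 = v - 2 * s + 1`; the claim is
`ψ * log n ≤ κ`. The proof has a combinatorial half, which turns the design into divisibility
conditions on `K` and `L`, and an arithmetic half, which only uses these conditions.

In a design of strength `2 * s`, the number of blocks that contain a set `I` and avoid a set `J`
depends only on the sizes of `I` and `J`, as long as they add up to at most `2 * s`
(`IsDesign.isRegularFamily`). As there are `v.choose s` blocks, the integrality of these numbers is
the condition `cover` of `IsAdmissible`. For a tight design the incidence matrix of `s`-subsets and
blocks is square and invertible (`IsRegularFamily.eq_zero_of_sum_eq_zero`), so there is an explicit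
polynomial of degree `s` which vanishes at all the differences `|A₀ \ A|` of a block `A₀` with the
other blocks. Averages of polynomials of degree at most `2 * s` over the blocks and over all
`k`-sets agree, and applying this to suitable nonnegative polynomials shows that there are exactly
`s` differences, no two of them consecutive. Hence `n ≥ 2 * s`, and the explicit polynomial is a
multiple of a monic one with integer roots; comparing coefficients in the basis of falling
factorials gives the condition `root` of `IsAdmissible`.

For the arithmetic half let `r = 2 * I + 2` and consider the test quotient with numerator
`K (K + 1) ⋯ (K + I) * L (L + 1) ⋯ (L + I)` and denominator
`n (n + 1) ⋯ (n + 2 * I) * n (n + 1) ⋯ (n + I - 1)`. By the inequality of arithmetic and geometric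
means it is at most `n ^ (1 - I) * 4 ^ (-(I + 1))` (`pow_mul_four_pow_mul_le`). On the other hand its
denominator cannot be too large relative to its numerator: for each prime `p`, the factor `n + j` of
the denominator with the highest power of `p` is matched, by `cover`, with factors of both products
in the numerator, or else that power is bounded by `root` (`IsAdmissible.factorization_le`). In
particular primes `p > s` contribute nothing, primes in `(b, s]` contribute at most what the sum
in `κ` records, up to a factor `s`, and the primes up to `b` are treated by the bound `3 / 2 * n` for
the single factors, which accounts for the term `4 * π(b)` in `ψ`
(`IsAdmissible.denominator_le`). The remaining factorials are compared in
`choose_mul_factorial_mul_le`.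
-/

/-! ### Valuations of products of consecutive integers -/

theorem ascFactorial_ne_zero {x : ℕ} (hx : x ≠ 0) (m : ℕ) : x.ascFactorial m ≠ 0 := by
  obtain ⟨y, rfl⟩ := Nat.exists_eq_succ_of_ne_zero hx
  exact (Nat.ascFactorial_pos y m).ne'

theorem ascFactorial_split (x : ℕ) {j m : ℕ} (hj : j < m) :
    x.ascFactorial m = x.ascFactorial j * (x + j) * (x + j + 1).ascFactorial (m - 1 - j) := by
  have h1 : x.ascFactorial m = x.ascFactorial (j + 1) * (x + (j + 1)).ascFactorial (m - 1 - j) := by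
    rw [Nat.ascFactorial_mul_ascFactorial]
    congr 1
    omega
  rw [h1, Nat.ascFactorial_succ, mul_comm (x + j), ← add_assoc]

theorem factorization_ascFactorial_split (p : ℕ) {x j m : ℕ} (hx : x ≠ 0) (hj : j < m) :
    (x.ascFactorial m).factorization p = (x.ascFactorial j).factorization p +
      (x + j).factorization p + ((x + j + 1).ascFactorial (m - 1 - j)).factorization p := by
  rw [ascFactorial_split x hj, Nat.factorization_mul (mul_ne_zero (ascFactorial_ne_zero hx j)
    (by omega)) (ascFactorial_ne_zero (by omega) _), Nat.factorization_mul
    (ascFactorial_ne_zero hx j) (by omega)]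
  simp

theorem factorization_ascFactorial_add (p : ℕ) {x : ℕ} (hx : x ≠ 0) (l m : ℕ) :
    (x.ascFactorial (l + m)).factorization p =
      (x.ascFactorial l).factorization p + ((x + l).ascFactorial m).factorization p := by
  rw [← Nat.ascFactorial_mul_ascFactorial, Nat.factorization_mul (ascFactorial_ne_zero hx l)
    (ascFactorial_ne_zero (by omega) _)]
  simp

theorem factorization_le_of_dvd (p : ℕ) {a b : ℕ} (hb : b ≠ 0) (h : a ∣ b) :
    a.factorization p ≤ b.factorization p :=
  (Nat.factorization_le_iff_dvd (ne_zero_of_dvd_ne_zero hb h) hb).2 h p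

theorem factorization_factorial_le_ascFactorial (p : ℕ) {x : ℕ} (hx : x ≠ 0) (m : ℕ) :
    (m !).factorization p ≤ (x.ascFactorial m).factorization p :=
  factorization_le_of_dvd p (ascFactorial_ne_zero hx m) (Nat.factorial_dvd_ascFactorial x m)

theorem factorization_factorial_mono (p : ℕ) {a b : ℕ} (h : a ≤ b) :
    (a !).factorization p ≤ (b !).factorization p :=
  factorization_le_of_dvd p b.factorial_ne_zero (Nat.factorial_dvd_factorial h)

theorem factorization_factorial_eq_choose (p : ℕ) {m i : ℕ} (h : i ≤ m) :
    (m !).factorization p = (m.choose i).factorization p + (i !).factorization p +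
      ((m - i)!).factorization p := by
  rw [← Nat.choose_mul_factorial_mul_factorial h, Nat.factorization_mul
    (mul_ne_zero (Nat.choose_pos h).ne' i.factorial_ne_zero) (m - i).factorial_ne_zero,
    Nat.factorization_mul (Nat.choose_pos h).ne' i.factorial_ne_zero]
  simp

theorem factorization_factorial_succ_le (p : ℕ) {a m : ℕ} (ha : 0 < a) (h : a ≤ m) :
    ((a - 1)!).factorization p + a.factorization p ≤ (m !).factorization p := by
  refine le_trans (le_of_eq ?_) (factorization_factorial_mono p h)
  rw [← Nat.mul_factorial_pred ha.ne', Nat.factorization_mul ha.ne' (Nat.factorial_ne_zero _)]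
  simp [add_comm]

/-- The general lower bound for the valuation of a product of consecutive integers with one
distinguished factor `x + j`: the factors before and after it form blocks of `j` and `m - 1 - j`
consecutive integers. -/
theorem le_factorization_ascFactorial (p : ℕ) {x j m : ℕ} (hx : x ≠ 0) (hj : j < m) :
    (x + j).factorization p + (j !).factorization p + ((m - 1 - j)!).factorization p ≤
      (x.ascFactorial m).factorization p := by
  rw [factorization_ascFactorial_split p hx hj]
  have h1 := factorization_factorial_le_ascFactorial p hx j
  have h2 := factorization_factorial_le_ascFactorial p (x := x + j + 1) (by omega) (m - 1 - j)
  omega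

theorem factorization_ascFactorial_above_le (p : ℕ) {y m : ℕ}
    (h : ∀ u, 1 ≤ u → u ≤ m → (y + u).factorization p ≤ u.factorization p) :
    ((y + 1).ascFactorial m).factorization p ≤ (m !).factorization p := by
  induction m with
  | zero => simp
  | succ m ih =>
    rw [Nat.ascFactorial_succ, Nat.factorial_succ, Nat.factorization_mul (by omega)
      (ascFactorial_ne_zero (by omega) _), Nat.factorization_mul (by omega) m.factorial_ne_zero]
    have h1 := ih fun u hu hum => h u hu (by omega)
    have h2 := h (m + 1) (by omega) le_rfl
    rw [show y + 1 + m = y + (m + 1) by ring]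
    simp only [Finsupp.add_apply]
    omega

theorem factorization_ascFactorial_below_le (p : ℕ) {x j : ℕ} (hx : x ≠ 0)
    (h : ∀ u, 1 ≤ u → u ≤ j → (x + j - u).factorization p ≤ u.factorization p) :
    (x.ascFactorial j).factorization p ≤ (j !).factorization p := by
  induction j generalizing x with
  | zero => simp
  | succ j ih =>
    rw [add_comm j 1, factorization_ascFactorial_add p hx 1 j, add_comm 1 j, Nat.factorial_succ,
      Nat.factorization_mul (by omega) j.factorial_ne_zero]
    have h1 := ih (x := x + 1) (by omega) fun u hu huj => by
      have := h u hu (by omega)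
      rwa [show x + 1 + j - u = x + (j + 1) - u by omega]
    have h2 := h (j + 1) (by omega) le_rfl
    rw [show x + (j + 1) - (j + 1) = x by omega] at h2
    simp only [Finsupp.add_apply, Nat.ascFactorial_succ, Nat.ascFactorial_zero, add_zero, mul_one]
    omega

theorem factorization_add_le_of_pow_dvd {p y u f : ℕ} (hp : p.Prime) (hy : p ^ f ∣ y)
    (hu : u ≠ 0) (h : u.factorization p < f) : (y + u).factorization p ≤ u.factorization p := by
  by_contra! hlt
  have h1 : p ^ (u.factorization p + 1) ∣ y + u :=
    (hp.pow_dvd_iff_le_factorization (by omega)).2 hlt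
  have h2 : p ^ (u.factorization p + 1) ∣ y := (pow_dvd_pow p h).trans hy
  have h3 := (hp.pow_dvd_iff_le_factorization hu).1 ((Nat.dvd_add_right h2).1 h1)
  omega

theorem factorization_lt_of_lt_pow {p u f : ℕ} (hp : p.Prime) (hu : u ≠ 0) (h : u < p ^ f) :
    u.factorization p < f := by
  have h1 := Nat.le_of_dvd (Nat.pos_of_ne_zero hu) (Nat.ordProj_dvd u p)
  exact (Nat.pow_lt_pow_iff_right hp.one_lt).1 (h1.trans_lt h)

/-- The general upper bound for the valuation of a product of consecutive integers, in terms of a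
factor `x + j` of maximal valuation: the valuation of `x + i` is at most that of `i - j`. -/
theorem factorization_ascFactorial_le_of_max {p x j m : ℕ} (hp : p.Prime) (hx : x ≠ 0) (hj : j < m)
    (hmax : ∀ i < m, (x + i).factorization p ≤ (x + j).factorization p) :
    (x.ascFactorial m).factorization p ≤
      (x + j).factorization p + (j !).factorization p + ((m - 1 - j)!).factorization p := by
  rw [factorization_ascFactorial_split p hx hj]
  have h1 : (x.ascFactorial j).factorization p ≤ (j !).factorization p := by
    refine factorization_ascFactorial_below_le p hx fun u hu huj => ?_
    have h := hmax (j - u) (by omega)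
    rw [show x + (j - u) = x + j - u by omega] at h
    have h2 := (Nat.dvd_sub ((pow_dvd_pow p h).trans (Nat.ordProj_dvd (x + j) p))
      (Nat.ordProj_dvd (x + j - u) p))
    rw [show x + j - (x + j - u) = u by omega] at h2
    exact (hp.pow_dvd_iff_le_factorization (by omega)).1 h2
  have h2 : ((x + j + 1).ascFactorial (m - 1 - j)).factorization p ≤
      ((m - 1 - j)!).factorization p := by
    refine factorization_ascFactorial_above_le p fun u hu huj => ?_
    have h := hmax (j + u) (by omega)
    rw [← add_assoc] at h
    have h2 := (Nat.dvd_sub (Nat.ordProj_dvd (x + j + u) p)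
      ((pow_dvd_pow p h).trans (Nat.ordProj_dvd (x + j) p)))
    rw [show x + j + u - (x + j) = u by omega] at h2
    exact (hp.pow_dvd_iff_le_factorization (by omega)).1 h2
  omega

/-- Some factor of a product of consecutive integers has maximal valuation. -/
theorem exists_max_factorization (p x : ℕ) {m : ℕ} (hm : 0 < m) :
    ∃ j < m, ∀ i < m, (x + i).factorization p ≤ (x + j).factorization p := by
  obtain ⟨j, hj, h⟩ := Finset.exists_max_image (Finset.range m)
    (fun i => (x + i).factorization p) ⟨0, by simpa using hm⟩
  exact ⟨j, by simpa using hj, fun i hi => h i (by simpa using hi)⟩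

/-- If no factor of a product of `m + 1` consecutive integers has valuation above `e`, then the
product has valuation at most `e` more than `m !`. -/
theorem factorization_ascFactorial_le_add {p x m e : ℕ} (hp : p.Prime) (hx : x ≠ 0)
    (h : ∀ i ≤ m, (x + i).factorization p ≤ e) :
    (x.ascFactorial (m + 1)).factorization p ≤ e + (m !).factorization p := by
  obtain ⟨j, hj, hmax⟩ := exists_max_factorization p x (m := m + 1) (by omega)
  have h1 := factorization_ascFactorial_le_of_max hp hx hj hmax
  have h2 := h j (by omega)
  have h3 := factorization_factorial_eq_choose p (show j ≤ m by omega)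
  rw [show m + 1 - 1 - j = m - j by omega] at h1
  omega

/-! ### The divisibility conditions and their local consequences -/

/-- The divisibility conditions which a nontrivial tight `2s`-`(v, k, l)` design imposes on
`K = k - s` and `L = v - k - s`; note that `K + L + 1 = v - 2s + 1`. The field `root` says that the
monic polynomial whose roots are the block differences has integral coefficients in the falling
factorial basis, and the field `cover` that the number of blocks containing one set and avoiding
another is an integer. -/
structure IsAdmissible (s K L : ℕ) : Prop where
  K_pos : 0 < K
  L_pos : 0 < L
  root : ∀ j < s, (K + L + 1).ascFactorial (j + 1) ∣
    s.choose (j + 1) * ((K + 1).ascFactorial (j + 1) * (L + 1).ascFactorial (j + 1))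
  cover : ∀ j < s, ∀ t, 1 ≤ t → t ≤ j + 1 → s ! * (K + L + 1 + j).ascFactorial (s - j) ∣
    (K + t).ascFactorial (s + 1 - t) * (L + (j + 2 - t)).ascFactorial (s + t - 1 - j)

namespace IsAdmissible

variable {s K L p I j t : ℕ}

theorem symm (h : IsAdmissible s K L) : IsAdmissible s L K where
  K_pos := h.L_pos
  L_pos := h.K_pos
  root j hj := by
    rw [add_comm L K, mul_comm ((L + 1).ascFactorial _)]
    exact h.root j hj
  cover j hj t ht htj := by
    have h1 := h.cover j hj (j + 2 - t) (by omega) (by omega)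
    rw [show j + 2 - (j + 2 - t) = t by omega, show s + (j + 2 - t) - 1 - j = s + 1 - t by omega,
      show s + 1 - (j + 2 - t) = s + t - 1 - j by omega, mul_comm ((K + _).ascFactorial _)] at h1
    rwa [add_comm L K]

theorem factorization_root (h : IsAdmissible s K L) (p : ℕ) (hj : j < s) :
    (K + L + 1 + j).factorization p + (j !).factorization p ≤
      (s.choose (j + 1)).factorization p + ((K + 1).ascFactorial (j + 1)).factorization p +
        ((L + 1).ascFactorial (j + 1)).factorization p := by
  have hK := ascFactorial_ne_zero (x := K + 1) (by omega) (j + 1)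
  have hL := ascFactorial_ne_zero (x := L + 1) (by omega) (j + 1)
  have hc := (Nat.choose_pos (show j + 1 ≤ s from hj)).ne'
  have h1 := factorization_le_of_dvd p (mul_ne_zero hc (mul_ne_zero hK hL)) (h.root j hj)
  have h2 := le_factorization_ascFactorial p (x := K + L + 1) (j := j) (m := j + 1)
    (by omega) (by omega)
  rw [Nat.factorization_mul hc (mul_ne_zero hK hL), Nat.factorization_mul hK hL] at h1
  simp only [Finsupp.add_apply] at h1
  omega

theorem factorization_cover (h : IsAdmissible s K L) (p : ℕ) (hj : j < s) (ht : 1 ≤ t)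
    (htj : t ≤ j + 1) :
    (s !).factorization p + (K + L + 1 + j).factorization p + ((s - 1 - j)!).factorization p ≤
      ((K + t).ascFactorial (s + 1 - t)).factorization p +
        ((L + (j + 1 - t) + 1).ascFactorial (s + t - 1 - j)).factorization p := by
  have hK := ascFactorial_ne_zero (x := K + t) (by omega) (s + 1 - t)
  have hL := ascFactorial_ne_zero (x := L + (j + 2 - t)) (by omega) (s + t - 1 - j)
  have hn := ascFactorial_ne_zero (x := K + L + 1 + j) (by omega) (s - j)
  have h1 := factorization_le_of_dvd p (mul_ne_zero hK hL) (h.cover j hj t ht htj)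
  have h2 := le_factorization_ascFactorial p (x := K + L + 1 + j) (j := 0) (m := s - j)
    (by omega) (by omega)
  rw [Nat.factorization_mul hK hL, Nat.factorization_mul s.factorial_ne_zero hn] at h1
  simp only [Finsupp.add_apply] at h1
  rw [show L + (j + 2 - t) = L + (j + 1 - t) + 1 by omega] at h1
  rw [show s - j - 1 - 0 = s - 1 - j by omega] at h2
  simp only [add_zero, Nat.factorial_zero, Nat.factorization_one, Finsupp.zero_apply] at h2
  omega

/-- If `p` divides both `K + L + 1 + j` and some `K + t` with `1 ≤ t ≤ j + 1` to a power above `s`,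
then the power of `p` in `K + L + 1 + j` divides `K + t` and `L + (j + 1 - t)`, up to a factor at
most `s - 1`. -/
theorem exists_pair_of_left (h : IsAdmissible s K L) (hp : p.Prime) {e : ℕ} (he : s < p ^ e)
    (hj : j < s) (ha : e ≤ (K + L + 1 + j).factorization p) (ht : 1 ≤ t) (htj : t ≤ j + 1)
    (hK : e ≤ (K + t).factorization p) :
    ∃ d ≤ Nat.log p (s - 1), (K + L + 1 + j).factorization p ≤ (K + t).factorization p + d ∧
      (K + L + 1 + j).factorization p ≤ (L + (j + 1 - t)).factorization p + d := by
  have hLpos := h.L_pos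
  have hKdvd : p ^ e ∣ K + t := (hp.pow_dvd_iff_le_factorization (by omega)).2 hK
  have hndvd : p ^ e ∣ K + L + 1 + j := (hp.pow_dvd_iff_le_factorization (by omega)).2 ha
  have hsum : K + t + (L + (j + 1 - t)) = K + L + 1 + j := by omega
  have hLdvd : p ^ e ∣ L + (j + 1 - t) := by
    rw [← hsum] at hndvd
    exact (Nat.dvd_add_right hKdvd).1 hndvd
  have hcov := h.factorization_cover p hj ht htj
  have hK1 : ((K + t + 1).ascFactorial (s - t)).factorization p ≤ ((s - t)!).factorization p :=
    factorization_ascFactorial_above_le p fun u hu hus =>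
      factorization_add_le_of_pow_dvd hp hKdvd (by omega)
        (factorization_lt_of_lt_pow hp (by omega) (by omega))
  have hK2 : ((K + t).ascFactorial (s + 1 - t)).factorization p =
      (K + t).factorization p + ((K + t + 1).ascFactorial (s - t)).factorization p := by
    rw [show s + 1 - t = 1 + (s - t) by omega, factorization_ascFactorial_add p (by omega)]
    simp [Nat.ascFactorial_succ]
  have hL1 : ((L + (j + 1 - t) + 1).ascFactorial (s + t - 1 - j)).factorization p ≤
      ((s + t - 1 - j)!).factorization p :=
    factorization_ascFactorial_above_le p fun u hu hus =>
      factorization_add_le_of_pow_dvd hp hLdvd (by omega)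
        (factorization_lt_of_lt_pow hp (by omega) (by omega))
  -- the binomial coefficient `(s + t - 1 - j).choose t` carries the whole loss
  obtain ⟨d, hd, hKd⟩ : ∃ d ≤ Nat.log p (s - 1),
      (K + L + 1 + j).factorization p ≤ (K + t).factorization p + d := by
    rcases Nat.lt_or_ge j t with hjt | hjt
    · obtain rfl : t = j + 1 := by omega
      refine ⟨0, by omega, ?_⟩
      rw [show s + (j + 1) - 1 - j = s by omega] at hL1 hcov
      rw [show s - (j + 1) = s - 1 - j by omega] at hK1 hK2
      omega
    · refine ⟨((s + t - 1 - j).choose t).factorization p, Nat.factorization_choose_le_log.trans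
        (Nat.log_mono_right (by omega)), ?_⟩
      have h1 := factorization_factorial_eq_choose p (show t ≤ s + t - 1 - j by omega)
      have h2 := factorization_factorial_eq_choose p (show t ≤ s by omega)
      rw [show s + t - 1 - j - t = s - 1 - j by omega] at h1
      omega
  refine ⟨d, hd, hKd, ?_⟩
  have h1 : p ^ ((K + L + 1 + j).factorization p - d) ∣ K + t :=
    (hp.pow_dvd_iff_le_factorization (by omega)).2 (by omega)
  have h2 : p ^ ((K + L + 1 + j).factorization p - d) ∣ K + t + (L + (j + 1 - t)) := by
    rw [hsum]
    exact (hp.pow_dvd_iff_le_factorization (by omega)).2 (by omega)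
  have h3 := (hp.pow_dvd_iff_le_factorization (by omega)).1 ((Nat.dvd_add_right h1).1 h2)
  omega

theorem exists_pair (h : IsAdmissible s K L) (hp : p.Prime) {e : ℕ} (he : s < p ^ e)
    (hj : j < s) (ha : e ≤ (K + L + 1 + j).factorization p)
    (ht : ∃ t, 1 ≤ t ∧ t ≤ j + 1 ∧ (e ≤ (K + t).factorization p ∨ e ≤ (L + t).factorization p)) :
    ∃ t ≤ j + 1, ∃ d ≤ Nat.log p (s - 1),
      (K + L + 1 + j).factorization p ≤ (K + t).factorization p + d ∧
      (K + L + 1 + j).factorization p ≤ (L + (j + 1 - t)).factorization p + d := by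
  obtain ⟨t, ht, htj, hK | hL⟩ := ht
  · exact ⟨t, htj, h.exists_pair_of_left hp he hj ha ht htj hK⟩
  · obtain ⟨d, hd, h1, h2⟩ := h.symm.exists_pair_of_left hp he hj (by rwa [add_comm L K]) ht htj hL
    rw [add_comm L K] at h1 h2
    refine ⟨j + 1 - t, by omega, d, hd, h2, ?_⟩
    rwa [show j + 1 - (j + 1 - t) = t by omega]

end IsAdmissible

/-- The base-`p` logarithms of `s - 2`, `s - 1` and `s` agree unless `s - 1` or `s` is a power of
`p`. -/
theorem log_trichotomy {p s : ℕ} (hp : p.Prime) (hs : 6 ≤ s) :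
    (Nat.log p s = Nat.log p (s - 2) ∧ Nat.log p (s - 1) = Nat.log p (s - 2)) ∨
    (s = p ^ (Nat.log p (s - 2) + 1) + 1 ∧ Nat.log p s = Nat.log p (s - 2) + 1 ∧
      Nat.log p (s - 1) = Nat.log p (s - 2) + 1) ∨
    (s = p ^ (Nat.log p (s - 2) + 1) ∧ Nat.log p s = Nat.log p (s - 2) + 1 ∧
      Nat.log p (s - 1) = Nat.log p (s - 2)) := by
  set e := Nat.log p (s - 2)
  have h1 : p ^ e ≤ s - 2 := Nat.pow_log_le_self p (by omega)
  have h2 : s - 2 < p ^ (e + 1) := Nat.lt_pow_succ_log_self hp.one_lt _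
  have h3 : p ^ (e + 1 + 1) = p ^ (e + 1) * p := pow_succ _ _
  have h4 : p ^ (e + 1) * 2 ≤ p ^ (e + 1) * p := Nat.mul_le_mul_left _ hp.two_le
  have key : ∀ m f, p ^ f ≤ m → m < p ^ (f + 1) → Nat.log p m = f := fun m f hm hm' =>
    Nat.log_eq_of_pow_le_of_lt_pow hm hm'
  rcases Nat.lt_or_ge s (p ^ (e + 1)) with h | h
  · exact Or.inl ⟨key _ _ (by omega) h, key _ _ (by omega) (by omega)⟩
  rcases Nat.lt_or_ge (s - 1) (p ^ (e + 1)) with h' | h'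
  · exact Or.inr (Or.inr ⟨by omega, key _ _ (by omega) (by omega), key _ _ (by omega) h'⟩)
  · exact Or.inr (Or.inl ⟨by omega, key _ _ (by omega) (by omega), key _ _ (by omega) (by omega)⟩)

theorem log_le_factorization_factorial {p s m : ℕ} (hp : p.Prime) (hm : m ≤ s) :
    Nat.log p m ≤ (s !).factorization p := by
  rw [← hp.pow_dvd_iff_le_factorization s.factorial_ne_zero]
  rcases Nat.eq_zero_or_pos m with rfl | hm0
  · simp
  · exact Nat.dvd_factorial (pow_pos hp.pos _) ((Nat.pow_log_le_self p hm0.ne').trans hm)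

/-- If `s` is a proper power of `p`, then the multiples `s` and `s - s / p` of `p` exceed `m`. -/
theorem three_add_factorization_factorial_le {p s m e : ℕ} (hp : p.Prime) (he : 1 ≤ e)
    (hs : s = p ^ (e + 1)) (hm : 2 * m + 2 ≤ s) :
    (m !).factorization p + 3 ≤ (s !).factorization p := by
  have h3 : p ^ (e + 1) = p ^ e * p := pow_succ _ _
  have h4 : p ^ e * 2 ≤ p ^ e * p := Nat.mul_le_mul_left _ hp.two_le
  have h5 : 0 < p ^ e := pow_pos hp.pos _
  have hb : e + 1 ≤ s.factorization p :=
    (hp.pow_dvd_iff_le_factorization (by omega)).1 (by rw [hs])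
  have hc : e ≤ (s - p ^ e).factorization p := (hp.pow_dvd_iff_le_factorization (by omega)).1
    (Nat.dvd_sub (by rw [hs]; exact pow_dvd_pow p (by omega)) dvd_rfl)
  have h6 := factorization_factorial_succ_le p (show 0 < s by omega) le_rfl
  have h7 := factorization_factorial_succ_le p (show 0 < s - p ^ e by omega)
    (show s - p ^ e ≤ s - 1 by omega)
  have h8 := factorization_factorial_mono p (show m ≤ s - p ^ e - 1 by omega)
  omega

theorem four_add_factorization_factorial_le {p s m e : ℕ} (hp : p.Prime) (he : 1 ≤ e)
    (hs : s = p ^ (e + 1)) (hs6 : 6 ≤ s) (hm : 2 * m + 4 ≤ s) :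
    (m !).factorization p + 4 ≤ (s !).factorization p := by
  have h3 : p ^ (e + 1) = p ^ e * p := pow_succ _ _
  have h4 : p ^ e * 2 ≤ p ^ e * p := Nat.mul_le_mul_left _ hp.two_le
  have h5 : 0 < p ^ e := pow_pos hp.pos _
  have hb : e + 1 ≤ s.factorization p :=
    (hp.pow_dvd_iff_le_factorization (by omega)).1 (by rw [hs])
  have hc : e ≤ (s - p ^ e).factorization p := (hp.pow_dvd_iff_le_factorization (by omega)).1
    (Nat.dvd_sub (by rw [hs]; exact pow_dvd_pow p (by omega)) dvd_rfl)
  have h6 := factorization_factorial_succ_le p (show 0 < s by omega) le_rfl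
  have h7 := factorization_factorial_succ_le p (show 0 < s - p ^ e by omega)
    (show s - p ^ e ≤ s - 1 by omega)
  have h8 := factorization_factorial_mono p (show m ≤ s - p ^ e - 1 by omega)
  rcases Nat.lt_or_ge e 2 with he2 | he2
  · -- for `s = p ^ 2` the multiple `s - 2 * p` is needed as well
    obtain rfl : e = 1 := by omega
    have hs' : s = p * p := by rw [hs]; ring
    have hp3 : 3 ≤ p := by
      by_contra! hlt
      have := hp.two_le
      obtain rfl : p = 2 := by omega
      omega
    have h9 : m + 1 ≤ s - 2 * p := by
      rcases Nat.lt_or_ge p 4 with hp4 | hp4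
      · obtain rfl : p = 3 := by omega
        omega
      · have : 4 * p ≤ p * p := Nat.mul_le_mul_right _ hp4
        omega
    have hd : 1 ≤ (s - 2 * p).factorization p :=
      (hp.pow_dvd_iff_le_factorization (by omega)).1 (by
        rw [hs', pow_one]
        exact Nat.dvd_sub (dvd_mul_left p p) (dvd_mul_left p 2))
    rw [pow_one] at h7 hc
    have h10 := factorization_factorial_succ_le p (show 0 < s - 2 * p by omega)
      (show s - 2 * p ≤ s - p - 1 by omega)
    have h11 := factorization_factorial_mono p (show m ≤ s - 2 * p - 1 by omega)
    omega
  · omega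

theorem factorization_factorial_mul_le (p : ℕ) {i m : ℕ} (h : i ≤ m) :
    (i !).factorization p + ((m - i)!).factorization p ≤ (m !).factorization p := by
  have := factorization_factorial_eq_choose p h
  omega

theorem factorization_choose_le (p : ℕ) {m i M : ℕ} (h : m ≤ M) :
    (m.choose i).factorization p ≤ Nat.log p M :=
  Nat.factorization_choose_le_log.trans (Nat.log_mono_right h)

/-! ### The valuation of the test quotient -/

/-- In a window of length `m`, the factors before a factor `x + j` of at least their valuation have
valuation at most `log p (m - 1)`. -/
theorem factorization_le_log_of_max {p x i j m : ℕ} (hp : p.Prime)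
    (hi : i < j) (hj : j < m) (h : (x + i).factorization p ≤ (x + j).factorization p) :
    (x + i).factorization p ≤ Nat.log p (m - 1) := by
  have h1 : p ^ (x + i).factorization p ∣ x + i + (j - i) := by
    rw [show x + i + (j - i) = x + j by omega]
    exact (hp.pow_dvd_iff_le_factorization (by omega)).2 h
  have h2 := Nat.le_of_dvd (by omega) ((Nat.dvd_add_right (Nat.ordProj_dvd _ _)).1 h1)
  exact Nat.le_log_of_pow_le hp.one_lt (by omega)

/-- The loss allowed at the prime `p`, apart from the factorials, in the comparison of the
numerator and the denominator of the test quotient. -/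
def valLoss (p s : ℕ) : ℕ :=
  2 * Nat.log p (s - 1) + 2 * Nat.log p (s - 2) + if p = s ∨ p + 1 = s then 1 else 0

namespace IsAdmissible

variable {s K L p I j t : ℕ}

theorem factorization_le_of_small (hp : p.Prime) (hI : 2 ≤ I) (hs : 2 * I + 2 ≤ s) (hK : 0 < K)
    (hL : 0 < L)
    (hsmall : ∀ i < 2 * I + 1, (K + L + 1 + i).factorization p ≤ Nat.log p s) :
    ((K + L + 1).ascFactorial (2 * I + 1)).factorization p +
        ((K + L + 1).ascFactorial I).factorization p ≤
      (K.ascFactorial (I + 1)).factorization p + (L.ascFactorial (I + 1)).factorization p +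
        (valLoss p s + (s !).factorization p + ((2 * I + 2)!).factorization p) := by
  have y1 := factorization_ascFactorial_le_add hp (x := K + L + 1) (m := 2 * I) (by omega)
    fun i hi => hsmall i (by omega)
  have y2 := factorization_ascFactorial_le_add hp (x := K + L + 1) (m := I - 1) (by omega)
    fun i hi => hsmall i (by omega)
  rw [show I - 1 + 1 = I by omega] at y2
  have x1 := factorization_factorial_le_ascFactorial p hK.ne' (I + 1)
  have x2 := factorization_factorial_le_ascFactorial p hL.ne' (I + 1)
  have c1 := factorization_factorial_eq_choose p (show I + 1 ≤ 2 * I by omega)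
  rw [show 2 * I - (I + 1) = I - 1 by omega] at c1
  have c2 := factorization_choose_le p (i := I + 1) (show 2 * I ≤ s - 2 by omega)
  have c3 := factorization_factorial_mono p (show I - 1 ≤ I + 1 by omega)
  have c4 := log_le_factorization_factorial hp (le_refl s)
  have c5 := factorization_factorial_mono p (show I - 1 ≤ 2 * I + 2 by omega)
  unfold valLoss
  rcases log_trichotomy hp (show 6 ≤ s by omega) with ⟨h1, h2⟩ | ⟨-, h1, h2⟩ | ⟨h0, h1, h2⟩
  · omega
  · omega
  · rcases Nat.eq_zero_or_pos (Nat.log p (s - 2)) with he | he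
    · rw [he] at h0
      simp only [zero_add, pow_one] at h0
      rw [if_pos (Or.inl h0.symm)]
      omega
    · omega

/-- The case in which a factor `n + j` of maximal valuation occurs in both products of the
denominator, and is matched by a factor `K + t` and a factor `L + (j + 1 - t)`. -/
theorem factorization_le_of_pair_lt (hp : p.Prime) (hs : 2 * I + 2 ≤ s) (hK : 0 < K)
    (hL : 0 < L) (hj : j < I)
    (hmax : ∀ i < 2 * I + 1, (K + L + 1 + i).factorization p ≤ (K + L + 1 + j).factorization p)
    {d : ℕ} (hd : d ≤ Nat.log p (s - 1)) (ht : t ≤ j + 1)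
    (hKd : (K + L + 1 + j).factorization p ≤ (K + t).factorization p + d)
    (hLd : (K + L + 1 + j).factorization p ≤ (L + (j + 1 - t)).factorization p + d) :
    ((K + L + 1).ascFactorial (2 * I + 1)).factorization p +
        ((K + L + 1).ascFactorial I).factorization p ≤
      (K.ascFactorial (I + 1)).factorization p + (L.ascFactorial (I + 1)).factorization p +
        (valLoss p s + (s !).factorization p + ((2 * I + 2)!).factorization p) := by
  have y1 := factorization_ascFactorial_le_of_max hp (by omega) (show j < 2 * I + 1 by omega) hmax
  have y2 := factorization_ascFactorial_le_of_max hp (by omega) hj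
    fun i hi => hmax i (by omega)
  have x1 := le_factorization_ascFactorial p hK.ne' (show t < I + 1 by omega)
  have x2 := le_factorization_ascFactorial p hL.ne' (show j + 1 - t < I + 1 by omega)
  rw [show 2 * I + 1 - 1 - j = 2 * I - j by omega] at y1
  rw [show I + 1 - 1 - t = I - t by omega] at x1
  rw [show I + 1 - 1 - (j + 1 - t) = I - (j + 1 - t) by omega] at x2
  have c1 := factorization_factorial_eq_choose p ht
  have c2 := factorization_choose_le p (i := t) (show j + 1 ≤ s - 2 by omega)
  have c3 := factorization_factorial_mono p (show j ≤ j + 1 by omega)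
  have c4 := factorization_factorial_eq_choose p (show 1 ≤ 2 * I - j by omega)
  rw [Nat.choose_one_right, Nat.factorial_one, Nat.factorization_one, Finsupp.zero_apply] at c4
  have c5 := factorization_factorial_eq_choose p (show I - t ≤ 2 * I - j - 1 by omega)
  rw [show 2 * I - j - 1 - (I - t) = I - (j + 1 - t) by omega] at c5
  have c6 := factorization_choose_le p (i := I - t) (show 2 * I - j - 1 ≤ s - 2 by omega)
  have c7 := factorization_choose_le p (i := 1) (show 2 * I - j ≤ s - 2 by omega)
  rw [Nat.choose_one_right] at c7
  have c8 := log_le_factorization_factorial hp (show s - 2 ≤ s by omega)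
  have c9 := factorization_factorial_mul_le p (show j ≤ I - 1 by omega)
  have c10 := factorization_factorial_mono p (show I - 1 ≤ 2 * I + 2 by omega)
  unfold valLoss
  omega

/-- The bound for the denominator when a factor `n + j` of maximal valuation occurs only in the longer
of its two products. -/
theorem factorization_denominator_le (hp : p.Prime) (hIj : I ≤ j)
    (hj : j < 2 * I + 1) (hI : 2 ≤ I) (hs : 2 * I + 2 ≤ s)
    (hmax : ∀ i < 2 * I + 1, (K + L + 1 + i).factorization p ≤ (K + L + 1 + j).factorization p) :
    ((K + L + 1).ascFactorial (2 * I + 1)).factorization p +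
        ((K + L + 1).ascFactorial I).factorization p ≤
      (K + L + 1 + j).factorization p + ((2 * I)!).factorization p + Nat.log p (s - 2) +
        ((I - 1)!).factorization p := by
  have y1 := factorization_ascFactorial_le_of_max hp (by omega) hj hmax
  have y2 := factorization_ascFactorial_le_add hp (x := K + L + 1) (m := I - 1)
    (e := Nat.log p (s - 2)) (by omega) fun i hi =>
      (factorization_le_log_of_max hp (show i < j by omega) hj (hmax i (by omega))).trans
        (Nat.log_mono_right (by omega))
  rw [show I - 1 + 1 = I by omega] at y2
  rw [show 2 * I + 1 - 1 - j = 2 * I - j by omega] at y1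
  have c1 := factorization_factorial_mul_le p (show j ≤ 2 * I by omega)
  omega

theorem factorization_le_of_pair_ge_left (hp : p.Prime) (hI : 2 ≤ I) (hs : 2 * I + 2 ≤ s)
    (hK : 0 < K) (hL : 0 < L) (hIj : I ≤ j) (hj : j < 2 * I + 1)
    (hmax : ∀ i < 2 * I + 1, (K + L + 1 + i).factorization p ≤ (K + L + 1 + j).factorization p)
    {d : ℕ} (hd : d ≤ Nat.log p (s - 1)) (ht : t ≤ I)
    (hKd : (K + L + 1 + j).factorization p ≤ (K + t).factorization p + d) :
    ((K + L + 1).ascFactorial (2 * I + 1)).factorization p +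
        ((K + L + 1).ascFactorial I).factorization p ≤
      (K.ascFactorial (I + 1)).factorization p + (L.ascFactorial (I + 1)).factorization p +
        (valLoss p s + (s !).factorization p + ((2 * I + 2)!).factorization p) := by
  have y := factorization_denominator_le hp hIj hj hI hs hmax
  have x1 := le_factorization_ascFactorial p hK.ne' (show t < I + 1 by omega)
  have x2 := factorization_factorial_le_ascFactorial p hL.ne' (I + 1)
  rw [show I + 1 - 1 - t = I - t by omega] at x1
  have c1 := factorization_factorial_eq_choose p ht
  have c2 := factorization_choose_le p (i := t) (show I ≤ s - 2 by omega)
  have c3 := factorization_factorial_eq_choose p (show I ≤ 2 * I by omega)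
  rw [show 2 * I - I = I by omega] at c3
  have c4 := factorization_choose_le p (i := I) (show 2 * I ≤ s - 2 by omega)
  have c5 := factorization_factorial_mono p (show I ≤ I + 1 by omega)
  have c6 := factorization_factorial_mono p (show I - 1 ≤ 2 * I + 2 by omega)
  have c7 := log_le_factorization_factorial hp (show s - 2 ≤ s by omega)
  have c8 : Nat.log p (s - 2) ≤ Nat.log p (s - 1) := Nat.log_mono_right (by omega)
  unfold valLoss
  omega

/-- The case in which no factor `K + t` or `L + t` is divisible by a power of `p` above `s`; the
valuation of `n + j` is then bounded through the condition `root`. -/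
theorem factorization_le_of_no_pair (h : IsAdmissible s K L) (hp : p.Prime) (hI : 2 ≤ I)
    (hs : 2 * I + 2 ≤ s) (hj : j < 2 * I + 1) (hps : p ≠ s)
    (hmax : ∀ i < 2 * I + 1, (K + L + 1 + i).factorization p ≤ (K + L + 1 + j).factorization p)
    (hK : ∀ t, 1 ≤ t → t ≤ j + 1 → (K + t).factorization p ≤ Nat.log p s)
    (hL : ∀ t, 1 ≤ t → t ≤ j + 1 → (L + t).factorization p ≤ Nat.log p s) :
    ((K + L + 1).ascFactorial (2 * I + 1)).factorization p +
        ((K + L + 1).ascFactorial I).factorization p ≤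
      (K.ascFactorial (I + 1)).factorization p + (L.ascFactorial (I + 1)).factorization p +
        (valLoss p s + (s !).factorization p + ((2 * I + 2)!).factorization p) := by
  have hK0 := h.K_pos
  have hL0 := h.L_pos
  have r := h.factorization_root p (show j < s by omega)
  have rc := factorization_choose_le p (i := j + 1) (le_refl s)
  have rK := factorization_ascFactorial_le_add hp (x := K + 1) (m := j) (e := Nat.log p s)
    (by omega) fun i hi => by
      rw [add_assoc, add_comm 1 i]
      exact hK _ (by omega) (by omega)
  have rL := factorization_ascFactorial_le_add hp (x := L + 1) (m := j) (e := Nat.log p s)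
    (by omega) fun i hi => by
      rw [add_assoc, add_comm 1 i]
      exact hL _ (by omega) (by omega)
  have g1 := factorization_factorial_mono p (show 2 * I ≤ 2 * I + 2 by omega)
  have hpred : ∀ m ≤ s - 2, Nat.log p s = Nat.log p (s - 2) + 1 →
      s = p ^ (Nat.log p (s - 2) + 1) + 1 →
      (m !).factorization p + Nat.log p s ≤ (s !).factorization p := by
    intro m hm h1 h0
    have k1 : Nat.log p (s - 2) + 1 ≤ (s - 1).factorization p :=
      (hp.pow_dvd_iff_le_factorization (by omega)).1 ⟨1, by omega⟩
    have k2 := factorization_factorial_succ_le p (show 0 < s - 1 by omega) (show s - 1 ≤ s by omega)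
    have k3 := factorization_factorial_mono p (show m ≤ s - 1 - 1 by omega)
    omega
  rcases Nat.lt_or_ge j I with hjI | hIj
  · have y1 := factorization_ascFactorial_le_of_max hp (by omega) hj hmax
    have y2 := factorization_ascFactorial_le_of_max hp (by omega) hjI
      fun i hi => hmax i (by omega)
    rw [show 2 * I + 1 - 1 - j = 2 * I - j by omega] at y1
    have hsplit : ∀ x, 0 < x → ((x + 1).ascFactorial (j + 1)).factorization p +
        ((I - 1 - j)!).factorization p ≤ (x.ascFactorial (I + 1)).factorization p := by
      intro x hx
      rw [show I + 1 = 1 + ((j + 1) + (I - 1 - j)) by omega,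
        factorization_ascFactorial_add p hx.ne' 1, factorization_ascFactorial_add p (by omega) (j + 1)]
      have := factorization_factorial_le_ascFactorial p (x := x + 1 + (j + 1)) (by omega)
        (I - 1 - j)
      omega
    have x1 := hsplit K hK0
    have x2 := hsplit L hL0
    have c1 := factorization_factorial_mul_le p (show j ≤ 2 * I by omega)
    have main : ((K + L + 1).ascFactorial (2 * I + 1)).factorization p +
        ((K + L + 1).ascFactorial I).factorization p ≤
      (K.ascFactorial (I + 1)).factorization p + (L.ascFactorial (I + 1)).factorization p +
        (4 * Nat.log p s + (j !).factorization p + ((2 * I + 2)!).factorization p) := by omega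
    have gj := factorization_factorial_mono p (show j ≤ s by omega)
    unfold valLoss
    rcases log_trichotomy hp (show 6 ≤ s by omega) with ⟨h1, h2⟩ | ⟨h0, h1, h2⟩ | ⟨h0, h1, h2⟩
    · omega
    · have := hpred j (by omega) h1 h0
      rcases Nat.eq_zero_or_pos (Nat.log p (s - 2)) with he | he
      · rw [he] at h0
        simp only [zero_add, pow_one] at h0
        rw [if_pos (Or.inr h0.symm)]
        omega
      · omega
    · have he : 1 ≤ Nat.log p (s - 2) := by
        rcases Nat.eq_zero_or_pos (Nat.log p (s - 2)) with he | he
        · rw [he] at h0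
          exact absurd (by simpa using h0.symm) hps
        · exact he
      have := four_add_factorization_factorial_le hp he h0 (by omega) (show 2 * j + 4 ≤ s by omega)
      omega
  · have y := factorization_denominator_le hp hIj hj hI hs hmax
    have hsplit : ∀ x, 0 < x →
        (∀ t, 1 ≤ t → t ≤ j + 1 → (x + t).factorization p ≤ Nat.log p s) →
        ((x + 1).ascFactorial (j + 1)).factorization p ≤
          (x.ascFactorial (I + 1)).factorization p + Nat.log p s + ((j - I)!).factorization p := by
      intro x hx hxt
      rw [show I + 1 = 1 + I by omega, show j + 1 = I + (j - I + 1) by omega,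
        factorization_ascFactorial_add p hx.ne' 1, factorization_ascFactorial_add p (by omega) I]
      have := factorization_ascFactorial_le_add hp (x := x + 1 + I) (m := j - I)
        (e := Nat.log p s) (by omega) fun i hi => by
          rw [add_assoc, add_assoc]
          exact hxt _ (by omega) (by omega)
      omega
    have x1 := hsplit K hK0 hK
    have x2 := hsplit L hL0 hL
    have c1 := factorization_factorial_mul_le p (show I ≤ j by omega)
    have c2 := factorization_factorial_mono p (show j - I ≤ I by omega)
    have c3 := factorization_factorial_mono p (show I - 1 ≤ I by omega)
    have main : ((K + L + 1).ascFactorial (2 * I + 1)).factorization p +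
        ((K + L + 1).ascFactorial I).factorization p ≤
      (K.ascFactorial (I + 1)).factorization p + (L.ascFactorial (I + 1)).factorization p +
        (3 * Nat.log p s + Nat.log p (s - 2) + (I !).factorization p +
          ((2 * I + 2)!).factorization p) := by omega
    have gI := factorization_factorial_mono p (show I ≤ s by omega)
    unfold valLoss
    rcases log_trichotomy hp (show 6 ≤ s by omega) with ⟨h1, h2⟩ | ⟨h0, h1, h2⟩ | ⟨h0, h1, h2⟩
    · omega
    · have := hpred I (by omega) h1 h0
      omega
    · have he : 1 ≤ Nat.log p (s - 2) := by
        rcases Nat.eq_zero_or_pos (Nat.log p (s - 2)) with he | he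
        · rw [he] at h0
          exact absurd (by simpa using h0.symm) hps
        · exact he
      have := three_add_factorization_factorial_le hp he h0 (show 2 * I + 2 ≤ s by omega)
      omega

end IsAdmissible

namespace IsAdmissible

variable {s K L p I j t : ℕ}

/-- For `p = s` prime, the factorial `s !` in the condition `cover` contributes one more factor
`p`. -/
theorem succ_factorization_le_of_prime_self (h : IsAdmissible p K L) (hp : p.Prime) (hj : j < p)
    (hn : p ∣ K + L + 1 + j) (ht : 1 ≤ t) (htj : t ≤ j) (hK : p ∣ K + t) :
    (K + L + 1 + j).factorization p + 1 ≤ (K + t).factorization p := by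
  have hsum : K + t + (L + (j + 1 - t)) = K + L + 1 + j := by omega
  have hLdvd : p ∣ L + (j + 1 - t) := by
    rw [← hsum] at hn
    exact (Nat.dvd_add_right hK).1 hn
  have hcov := h.factorization_cover p hj ht (by omega)
  have hfac : ∀ m < p, (m !).factorization p = 0 := fun m hm =>
    Nat.factorization_factorial_eq_zero_of_lt hm
  have hzero : ∀ u, 1 ≤ u → u < p → u.factorization p < 1 := fun u hu hup =>
    factorization_lt_of_lt_pow hp (by omega) (by simpa using hup)
  have hK1 : ((K + t + 1).ascFactorial (p - t)).factorization p ≤ ((p - t)!).factorization p :=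
    factorization_ascFactorial_above_le p fun u hu hus =>
      factorization_add_le_of_pow_dvd hp (f := 1) (by simpa using hK) (by omega)
        (hzero u hu (by omega))
  have hK2 : ((K + t).ascFactorial (p + 1 - t)).factorization p =
      (K + t).factorization p + ((K + t + 1).ascFactorial (p - t)).factorization p := by
    rw [show p + 1 - t = 1 + (p - t) by omega, factorization_ascFactorial_add p (by omega)]
    simp [Nat.ascFactorial_succ]
  have hL1 : ((L + (j + 1 - t) + 1).ascFactorial (p + t - 1 - j)).factorization p ≤
      ((p + t - 1 - j)!).factorization p :=
    factorization_ascFactorial_above_le p fun u hu hus =>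
      factorization_add_le_of_pow_dvd hp (f := 1) (by simpa using hLdvd) (by omega)
        (hzero u hu (by omega))
  rw [hfac _ (by omega)] at hL1 hK1
  have hp1 : 1 ≤ (p !).factorization p := by
    rw [← hp.pow_dvd_iff_le_factorization p.factorial_ne_zero, pow_one]
    exact Nat.dvd_factorial hp.pos le_rfl
  omega

theorem not_dvd_of_prime_self (h : IsAdmissible p K L) (hp : p.Prime) (hj : j < p)
    (hn : p ∣ K + L + 1 + j) (ht : 1 ≤ t) (htj : t ≤ j) : ¬ p ∣ K + t := by
  intro hK
  have hL0 := h.L_pos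
  have hsum : K + t + (L + (j + 1 - t)) = K + L + 1 + j := by omega
  have hLdvd : p ∣ L + (j + 1 - t) := by
    rw [← hsum] at hn
    exact (Nat.dvd_add_right hK).1 hn
  have h1 := h.succ_factorization_le_of_prime_self hp hj hn ht htj hK
  have h2 := h.symm.succ_factorization_le_of_prime_self hp hj (by rwa [add_comm L K])
    (show 1 ≤ j + 1 - t by omega) (by omega) hLdvd
  rw [add_comm L K] at h2
  -- both summands of `K + L + 1 + j` would have a larger valuation than the sum
  have h3 := Nat.dvd_add ((hp.pow_dvd_iff_le_factorization (by omega)).2 h1)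
    ((hp.pow_dvd_iff_le_factorization (by omega)).2 h2)
  rw [hsum, hp.pow_dvd_iff_le_factorization (by omega)] at h3
  omega

/-- For `p = s` prime, `p` can divide `K + 1, …, K + (j + 1)` only through the last factor. -/
theorem factorization_root_prime_self (h : IsAdmissible p K L) (hp : p.Prime) (hj : j < p)
    (hn : p ∣ K + L + 1 + j) : ((K + 1).ascFactorial (j + 1)).factorization p ≤
      (K + (j + 1)).factorization p := by
  have h1 := factorization_ascFactorial_le_add hp (x := K + 1) (m := j)
    (e := (K + (j + 1)).factorization p) (by omega) fun i hi => by
      rw [add_assoc, add_comm 1 i]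
      rcases Nat.lt_or_ge i j with hij | hij
      · rw [Nat.factorization_eq_zero_of_not_dvd
          (h.not_dvd_of_prime_self hp hj hn (show 1 ≤ i + 1 by omega) (by omega))]
        omega
      · rw [show i = j by omega]
  rw [Nat.factorization_factorial_eq_zero_of_lt hj] at h1
  omega

theorem factorization_le_of_no_pair_prime_self (h : IsAdmissible p K L) (hp : p.Prime) (hI : 2 ≤ I)
    (hs : 2 * I + 2 ≤ p) (hj : j < 2 * I + 1) (hn : p ∣ K + L + 1 + j)
    (hmax : ∀ i < 2 * I + 1, (K + L + 1 + i).factorization p ≤ (K + L + 1 + j).factorization p)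
    (hK : (K + (j + 1)).factorization p ≤ 1) (hL : (L + (j + 1)).factorization p ≤ 1) :
    ((K + L + 1).ascFactorial (2 * I + 1)).factorization p +
        ((K + L + 1).ascFactorial I).factorization p ≤
      (K.ascFactorial (I + 1)).factorization p + (L.ascFactorial (I + 1)).factorization p + 2 := by
  have hK0 := h.K_pos
  have hL0 := h.L_pos
  have hfac : ∀ m < p, (m !).factorization p = 0 := fun m hm =>
    Nat.factorization_factorial_eq_zero_of_lt hm
  have r := h.factorization_root p (show j < p by omega)
  have rc := factorization_choose_le p (i := j + 1) (le_refl p)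
  have hlog : Nat.log p p = 1 := by simpa using Nat.log_pow hp.one_lt 1
  have rK := h.factorization_root_prime_self hp (show j < p by omega) hn
  have rL := h.symm.factorization_root_prime_self hp (show j < p by omega)
    (by rwa [add_comm L K])
  -- at most one of `K + (j + 1)` and `L + (j + 1)` is a multiple of `p`
  have hKL : ∀ x y, 0 < x → 0 < y → x + y = K + L → 1 ≤ (x + (j + 1)).factorization p →
      (y + (j + 1)).factorization p = 0 ∧ 1 ≤ y.factorization p := by
    intro x y hx hy hxy h1
    have hx1 : p ∣ x + (j + 1) := by
      simpa using (hp.pow_dvd_iff_le_factorization (by omega)).2 h1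
    have hy1 : p ∣ y := by
      rw [show K + L + 1 + j = x + (j + 1) + y by omega] at hn
      exact (Nat.dvd_add_right hx1).1 hn
    refine ⟨Nat.factorization_eq_zero_of_not_dvd fun h2 => ?_,
      (hp.pow_dvd_iff_le_factorization (by omega)).1 (by simpa using hy1)⟩
    have := Nat.le_of_dvd (by omega) ((Nat.dvd_add_right hy1).1 h2)
    omega
  have k1 := hKL K L hK0 hL0 rfl
  have k2 := hKL L K hL0 hK0 (add_comm L K)
  rcases Nat.lt_or_ge j I with hjI | hIj
  · have y1 := factorization_ascFactorial_le_of_max hp (by omega) hj hmax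
    have y2 := factorization_ascFactorial_le_of_max hp (by omega) hjI
      fun i hi => hmax i (by omega)
    rw [hfac _ (by omega), hfac _ (by omega)] at y1 y2
    have x1 := le_factorization_ascFactorial p hK0.ne' (show 0 < I + 1 by omega)
    have x2 := le_factorization_ascFactorial p hL0.ne' (show 0 < I + 1 by omega)
    have x3 := le_factorization_ascFactorial p hK0.ne' (show j + 1 < I + 1 by omega)
    have x4 := le_factorization_ascFactorial p hL0.ne' (show j + 1 < I + 1 by omega)
    rw [add_zero] at x1 x2
    omega
  · have y := factorization_denominator_le hp hIj hj hI hs hmax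
    have hlog2 : Nat.log p (p - 2) = 0 := Nat.log_of_lt (by omega)
    rw [hfac _ (by omega), hfac _ (by omega), hlog2] at y
    omega

/-- The valuation of the denominator of the test quotient exceeds that of the numerator by a
bounded amount, which vanishes for primes `p > s`. -/
theorem factorization_le (h : IsAdmissible s K L) (hp : p.Prime) (hI : 2 ≤ I)
    (hs : 2 * I + 2 ≤ s) :
    ((K + L + 1).ascFactorial (2 * I + 1)).factorization p +
        ((K + L + 1).ascFactorial I).factorization p ≤
      (K.ascFactorial (I + 1)).factorization p + (L.ascFactorial (I + 1)).factorization p +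
        (valLoss p s + (s !).factorization p + ((2 * I + 2)!).factorization p) := by
  have hK0 := h.K_pos
  have hL0 := h.L_pos
  obtain ⟨j, hj, hmax⟩ := exists_max_factorization p (K + L + 1) (show 0 < 2 * I + 1 by omega)
  rcases Nat.lt_or_ge (Nat.log p s) ((K + L + 1 + j).factorization p) with ha | ha
  swap
  · exact factorization_le_of_small hp hI hs hK0 hL0 fun i hi => (hmax i hi).trans ha
  by_cases hpair : ∃ t, 1 ≤ t ∧ t ≤ j + 1 ∧
      (Nat.log p s + 1 ≤ (K + t).factorization p ∨ Nat.log p s + 1 ≤ (L + t).factorization p)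
  · obtain ⟨t, ht, d, hd, hKd, hLd⟩ := h.exists_pair hp (Nat.lt_pow_succ_log_self hp.one_lt s)
      (show j < s by omega) ha hpair
    rcases Nat.lt_or_ge j I with hjI | hIj
    · exact factorization_le_of_pair_lt hp hs hK0 hL0 hjI hmax hd ht hKd hLd
    · rcases Nat.lt_or_ge I t with hIt | hIt
      · have h1 := factorization_le_of_pair_ge_left hp hI hs hL0 hK0 hIj hj
          (by rwa [add_comm L K]) hd (show j + 1 - t ≤ I by omega) (by rwa [add_comm L K])
        rw [add_comm L K] at h1
        omega
      · exact factorization_le_of_pair_ge_left hp hI hs hK0 hL0 hIj hj hmax hd hIt hKd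
  · have hK : ∀ t, 1 ≤ t → t ≤ j + 1 → (K + t).factorization p ≤ Nat.log p s := by
      intro t ht htj
      by_contra hlt
      exact hpair ⟨t, ht, htj, Or.inl (by omega)⟩
    have hL : ∀ t, 1 ≤ t → t ≤ j + 1 → (L + t).factorization p ≤ Nat.log p s := by
      intro t ht htj
      by_contra hlt
      exact hpair ⟨t, ht, htj, Or.inr (by omega)⟩
    rcases eq_or_ne p s with rfl | hps
    · have hlog : Nat.log p p = 1 := by simpa using Nat.log_pow hp.one_lt 1
      rw [hlog] at hK hL
      have h1 := h.factorization_le_of_no_pair_prime_self hp hI hs hj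
        (Nat.dvd_of_factorization_pos (by omega)) hmax (hK _ (by omega) le_rfl)
        (hL _ (by omega) le_rfl)
      have h2 := log_le_factorization_factorial hp (le_refl p)
      unfold valLoss
      rw [if_pos (Or.inl rfl)]
      omega
    · exact h.factorization_le_of_no_pair hp hI hs hj hps hmax hK hL

end IsAdmissible

/-- A bound for the valuation of the test quotient at a small prime, by two factors of the
denominator and a binomial-like integer. -/
theorem exists_factorization_le {p n K L I : ℕ} (hp : p.Prime) (hn : 0 < n) (hK : 0 < K)
    (hL : 0 < L) (hI : 2 ≤ I) :
    ∃ a a', p ^ a ≤ n + 2 * I ∧ p ^ a' ≤ n + (I - 1) ∧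
      (n.ascFactorial (2 * I + 1)).factorization p + (n.ascFactorial I).factorization p ≤
      (K.ascFactorial (I + 1)).factorization p + (L.ascFactorial (I + 1)).factorization p +
        (a + a' + ((2 * I).choose (I + 1) * (I - 1)!).factorization p) := by
  obtain ⟨j, hj, hmax⟩ := exists_max_factorization p n (show 0 < 2 * I + 1 by omega)
  obtain ⟨i, hi, hmax'⟩ := exists_max_factorization p n (show 0 < I by omega)
  refine ⟨(n + j).factorization p, (n + i).factorization p,
    (Nat.le_of_dvd (by omega) (Nat.ordProj_dvd _ _)).trans (by omega),
    (Nat.le_of_dvd (by omega) (Nat.ordProj_dvd _ _)).trans (by omega), ?_⟩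
  have y1 := factorization_ascFactorial_le_of_max hp hn.ne' hj hmax
  have y2 := factorization_ascFactorial_le_of_max hp hn.ne' hi hmax'
  have x1 := factorization_factorial_le_ascFactorial p hK.ne' (I + 1)
  have x2 := factorization_factorial_le_ascFactorial p hL.ne' (I + 1)
  have c1 := factorization_factorial_eq_choose p (show I + 1 ≤ 2 * I by omega)
  rw [show 2 * I - (I + 1) = I - 1 by omega] at c1
  have c2 := factorization_factorial_mul_le p (show j ≤ 2 * I by omega)
  have c3 := factorization_factorial_mul_le p (show i ≤ I - 1 by omega)
  have c4 := factorization_factorial_mono p (show I - 1 ≤ I + 1 by omega)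
  rw [show 2 * I + 1 - 1 - j = 2 * I - j by omega] at y1
  rw [Nat.factorization_mul (Nat.choose_pos (by omega)).ne' (Nat.factorial_ne_zero _)]
  simp only [Finsupp.add_apply]
  omega

/-! ### From the valuations to the bound -/

/-- By the inequality between arithmetic and geometric means, the numerator of the test quotient is
small compared to its denominator. -/
theorem four_pow_mul_le (K L m : ℕ) :
    4 ^ (m + 1) * (K.ascFactorial (m + 1) * L.ascFactorial (m + 1)) ≤
      (K + L) ^ 2 * (K + L + 2).ascFactorial (2 * m) := by
  induction m with
  | zero =>
    simp only [zero_add, pow_one, Nat.ascFactorial_succ, Nat.ascFactorial_zero, mul_zero]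
    have := four_mul_le_pow_two_add K L
    nlinarith
  | succ m ih =>
    have h1 : 4 * ((K + (m + 1)) * (L + (m + 1))) ≤
        (K + L + 2 + (2 * m + 1)) * (K + L + 2 + 2 * m) := by
      have := four_mul_le_pow_two_add (K + (m + 1)) (L + (m + 1))
      nlinarith
    rw [show 2 * (m + 1) = 2 * m + 1 + 1 by ring, Nat.ascFactorial_succ (k := 2 * m + 1),
      Nat.ascFactorial_succ (k := 2 * m), Nat.ascFactorial_succ (n := K) (k := m + 1),
      Nat.ascFactorial_succ (n := L) (k := m + 1)]
    calc 4 ^ (m + 1 + 1) * ((K + (m + 1)) * K.ascFactorial (m + 1) *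
          ((L + (m + 1)) * L.ascFactorial (m + 1)))
        = 4 * ((K + (m + 1)) * (L + (m + 1))) *
          (4 ^ (m + 1) * (K.ascFactorial (m + 1) * L.ascFactorial (m + 1))) := by ring
      _ ≤ _ := Nat.mul_le_mul h1 ih
      _ = _ := by ring

theorem pow_mul_four_pow_mul_le (K L : ℕ) {I : ℕ} (hI : 1 ≤ I) :
    (K + L + 1) ^ (I - 1) * 4 ^ (I + 1) * (K.ascFactorial (I + 1) * L.ascFactorial (I + 1)) ≤
      (K + L + 1).ascFactorial (2 * I + 1) * (K + L + 1).ascFactorial I := by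
  have h1 := four_pow_mul_le K L I
  have h2 : (K + L + 1).ascFactorial (2 * I + 1) =
      (K + L + 1) * (K + L + 2).ascFactorial (2 * I) := by
    rw [add_comm (2 * I) 1, ← Nat.ascFactorial_mul_ascFactorial]
    simp [Nat.ascFactorial_succ]
  have h3 : (K + L + 1) ^ I ≤ (K + L + 1).ascFactorial I := Nat.pow_succ_le_ascFactorial _ _
  obtain ⟨m, rfl⟩ : ∃ m, I = m + 1 := ⟨I - 1, by omega⟩
  rw [h2]
  calc (K + L + 1) ^ (m + 1 - 1) * 4 ^ (m + 1 + 1) *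
        (K.ascFactorial (m + 1 + 1) * L.ascFactorial (m + 1 + 1))
      = (K + L + 1) ^ m * (4 ^ (m + 1 + 1) *
        (K.ascFactorial (m + 1 + 1) * L.ascFactorial (m + 1 + 1))) := by
        rw [Nat.add_sub_cancel]; ring
    _ ≤ (K + L + 1) ^ m * ((K + L + 1) ^ 2 * (K + L + 2).ascFactorial (2 * (m + 1))) := by
        refine Nat.mul_le_mul_left _ (h1.trans (Nat.mul_le_mul_right _ ?_))
        exact Nat.pow_le_pow_left (by omega) 2
    _ = (K + L + 1) * (K + L + 2).ascFactorial (2 * (m + 1)) * (K + L + 1) ^ (m + 1) := by ring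
    _ ≤ _ := Nat.mul_le_mul_left _ h3

theorem four_mul_choose_le {m : ℕ} (hm : 1 ≤ m) : 4 * (2 * m).choose (m + 1) ≤ 4 ^ m := by
  induction m, hm using Nat.le_induction with
  | base => decide
  | succ m hm ih =>
    have h0 : (2 * m).choose m * m = (2 * m).choose (m + 1) * (m + 1) := by
      have := Nat.choose_succ_right_eq (2 * m) m
      rw [show 2 * m - m = m by omega] at this
      exact this.symm
    have h1 : (2 * m).choose (m + 2) * (m + 2) = (2 * m).choose (m + 1) * (m - 1) := by
      have := Nat.choose_succ_right_eq (2 * m) (m + 1)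
      rwa [show 2 * m - (m + 1) = m - 1 by omega] at this
    have h2 : (2 * (m + 1)).choose (m + 1 + 1) = (2 * m).choose m + 2 * (2 * m).choose (m + 1) +
        (2 * m).choose (m + 2) := by
      rw [show 2 * (m + 1) = 2 * m + 1 + 1 by ring, Nat.choose_succ_succ, Nat.choose_succ_succ,
        Nat.choose_succ_succ]
      ring
    obtain ⟨i, rfl⟩ : ∃ i, m = i + 1 := ⟨m - 1, by omega⟩
    rw [h2, pow_succ]
    simp only [Nat.add_sub_cancel] at h1
    set a := (2 * (i + 1)).choose (i + 1)
    set b := (2 * (i + 1)).choose (i + 1 + 1)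
    set c := (2 * (i + 1)).choose (i + 1 + 2)
    -- `a + c ≤ 2 * b`
    have h3 : (a + c) * ((i + 1) * (i + 3)) ≤ 2 * b * ((i + 1) * (i + 3)) := by
      have e1 : a * ((i + 1) * (i + 3)) = b * ((i + 2) * (i + 3)) := by
        calc a * ((i + 1) * (i + 3)) = a * (i + 1) * (i + 3) := by ring
          _ = _ := by rw [h0]; ring
      have e2 : c * ((i + 1) * (i + 3)) = b * (i * (i + 1)) := by
        calc c * ((i + 1) * (i + 3)) = c * (i + 1 + 2) * (i + 1) := by ring
          _ = _ := by rw [h1]; ring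
      rw [add_mul, e1, e2]
      nlinarith [Nat.zero_le (b * i), Nat.zero_le b]
    have h4 := Nat.le_of_mul_le_mul_right h3 (by positivity)
    omega

theorem choose_mul_factorial_mul_le (I g : ℕ) (hI : 2 ≤ I) :
    (2 * I).choose (I + 1) * (I - 1)! * ((2 * (I + 2 + g))! * (g + 1)! * (I + 2 + g)) ≤
      2 ^ (2 * I + 2 + g) * ((I + 3 + 2 * g)! * (2 * I + 1 + g)!) := by
  induction g with
  | zero =>
    obtain ⟨i, rfl⟩ : ∃ i, I = i + 1 := ⟨I - 1, by omega⟩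
    have h1 := four_mul_choose_le (show 1 ≤ i + 1 by omega)
    have h2 : (2 * (i + 1 + 2))! = (2 * i + 6) * (2 * i + 5) * (2 * i + 4) * (2 * i + 3)! := by
      rw [show 2 * (i + 1 + 2) = 2 * i + 3 + 1 + 1 + 1 by ring, Nat.factorial_succ,
        Nat.factorial_succ, Nat.factorial_succ]
      ring
    have h3 : (i + 1 + 3)! = (i + 4) * (i + 3) * (i + 2) * (i + 1) * i ! := by
      rw [show i + 1 + 3 = i + 1 + 1 + 1 + 1 by ring, Nat.factorial_succ, Nat.factorial_succ,
        Nat.factorial_succ, Nat.factorial_succ]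
      ring
    simp only [add_zero, mul_zero, zero_add, Nat.factorial_one, mul_one, Nat.add_sub_cancel]
    rw [h2, h3, show 2 * (i + 1) + 1 = 2 * i + 3 by ring,
      show 2 * (i + 1) + 2 = 2 * (i + 1) + 2 * 1 by ring, ← mul_add, pow_mul,
      show (2 : ℕ) ^ 2 = 4 by rfl, pow_succ 4 (i + 1)]
    set C := (2 * (i + 1)).choose (i + 1 + 1)
    have h4 : (2 * i + 6) * (2 * i + 5) * (2 * i + 4) * (i + 1 + 2) ≤
        16 * ((i + 4) * (i + 3) * (i + 2) * (i + 1)) := by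
      have : 1 ≤ i := by omega
      obtain ⟨u, rfl⟩ : ∃ u, i = u + 1 := ⟨i - 1, by omega⟩
      ring_nf
      gcongr <;> norm_num
    calc C * i ! * ((2 * i + 6) * (2 * i + 5) * (2 * i + 4) * (2 * i + 3)! * (i + 1 + 2))
        = C * (i ! * (2 * i + 3)!) *
          ((2 * i + 6) * (2 * i + 5) * (2 * i + 4) * (i + 1 + 2)) := by ring
      _ ≤ C * (i ! * (2 * i + 3)!) * (16 * ((i + 4) * (i + 3) * (i + 2) * (i + 1))) :=
          Nat.mul_le_mul_left _ h4
      _ = 4 * C * 4 * ((i + 4) * (i + 3) * (i + 2) * (i + 1) * i ! * (2 * i + 3)!) := by ring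
      _ ≤ _ := Nat.mul_le_mul_right _ (Nat.mul_le_mul_right _ h1)
  | succ g ih =>
    have h1 : (2 * (I + 2 + (g + 1)))! =
        (2 * I + 2 * g + 6) * (2 * I + 2 * g + 5) * (2 * (I + 2 + g))! := by
      rw [show 2 * (I + 2 + (g + 1)) = 2 * (I + 2 + g) + 1 + 1 by ring, Nat.factorial_succ,
        Nat.factorial_succ]
      ring
    have h2 : (I + 3 + 2 * (g + 1))! =
        (I + 2 * g + 5) * (I + 2 * g + 4) * (I + 3 + 2 * g)! := by
      rw [show I + 3 + 2 * (g + 1) = I + 3 + 2 * g + 1 + 1 by ring, Nat.factorial_succ,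
        Nat.factorial_succ]
      ring
    have h3 : (2 * I + 1 + (g + 1))! = (2 * I + g + 2) * (2 * I + 1 + g)! := by
      rw [show 2 * I + 1 + (g + 1) = 2 * I + 1 + g + 1 by ring, Nat.factorial_succ]
      ring
    have h4 : (g + 1 + 1)! = (g + 2) * (g + 1)! := by rw [Nat.factorial_succ]
    have h5 : (2 * I + 2 * g + 6) * (2 * I + 2 * g + 5) * (g + 2) * (I + g + 3) ≤
        2 * ((I + 2 * g + 5) * (I + 2 * g + 4) * (2 * I + g + 2)) * (I + 2 + g) := by
      obtain ⟨u, rfl⟩ : ∃ u, I = u + 2 := ⟨I - 2, by omega⟩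
      zify
      rw [← sub_nonneg]
      ring_nf
      positivity
    rw [h1, h2, h3, h4, show 2 * I + 2 + (g + 1) = 2 * I + 2 + g + 1 by ring, pow_succ]
    refine Nat.le_of_mul_le_mul_right ?_ (show 0 < I + 2 + g by omega)
    calc (2 * I).choose (I + 1) * (I - 1)! * ((2 * I + 2 * g + 6) * (2 * I + 2 * g + 5) *
          (2 * (I + 2 + g))! * ((g + 2) * (g + 1)!) * (I + 2 + (g + 1))) * (I + 2 + g)
        = (2 * I).choose (I + 1) * (I - 1)! * ((2 * (I + 2 + g))! * (g + 1)! * (I + 2 + g)) *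
          ((2 * I + 2 * g + 6) * (2 * I + 2 * g + 5) * (g + 2) * (I + g + 3)) := by ring
      _ ≤ _ := Nat.mul_le_mul ih h5
      _ = _ := by ring

theorem ell_ne_zero (m : ℕ) : ell m ≠ 0 := by
  unfold ell
  rw [Ne, Finset.lcm_eq_zero_iff]
  rintro ⟨i, -, hi⟩
  rw [Finset.lcm_eq_zero_iff] at hi
  obtain ⟨j, hj, hj0⟩ := hi
  exact (Nat.choose_pos (Nat.lt_succ_iff.1 (by simpa using hj))).ne' hj0

theorem dvd_ell {i m : ℕ} (hi : 1 ≤ i) (him : i ≤ m) : i ∣ ell m := by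
  have h1 : (Finset.range (i + 1)).lcm (fun j => i.choose j) ∣ ell m :=
    Finset.dvd_lcm (f := fun i => (Finset.range (i + 1)).lcm fun j => i.choose j)
      (Finset.mem_range.2 (by omega))
  have h2 : i.choose 1 ∣ (Finset.range (i + 1)).lcm (fun j => i.choose j) :=
    Finset.dvd_lcm (f := fun j => i.choose j) (Finset.mem_range.2 (by omega))
  rw [Nat.choose_one_right] at h2
  exact h2.trans h1

theorem log_le_factorization_ell {p m : ℕ} (hp : p.Prime) (hm : 1 ≤ m) :
    Nat.log p m ≤ (ell m).factorization p :=
  (hp.pow_dvd_iff_le_factorization (ell_ne_zero m)).1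
    (dvd_ell (Nat.one_le_pow _ _ hp.pos) (Nat.pow_log_le_self p (by omega)))

theorem valLoss_add_le {p s r : ℕ} (hp : p.Prime) (hs : 3 ≤ s) :
    valLoss p s + (s !).factorization p + (r !).factorization p ≤
      padicValNat p (Ftilde s r) + if p = s ∨ p + 1 = s then 1 else 0 := by
  have e1 := ell_ne_zero (s - 1)
  have e2 := ell_ne_zero (s - 2)
  have f := Nat.factorial_ne_zero
  rw [← Nat.factorization_def _ hp]
  unfold Ftilde valLoss
  rw [Nat.factorization_mul (by simp [f, e1, e2]) (by omega),
    Nat.factorization_mul (by simp [f, e1, e2]) (f _),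
    Nat.factorization_mul (by simp [f, e1]) (by simp [e2]),
    Nat.factorization_mul (by simp [f]) (by simp [e1]), Nat.factorization_mul (f _) (f _),
    Nat.factorization_pow, Nat.factorization_pow]
  simp only [Finsupp.add_apply, Finsupp.smul_apply, smul_eq_mul]
  have h1 := log_le_factorization_ell hp (show 1 ≤ s - 1 by omega)
  have h2 := log_le_factorization_ell hp (show 1 ≤ s - 2 by omega)
  omega

/-- At most one of `s - 1` and `s` is prime. -/
theorem prod_pow_ite_le {s : ℕ} (hs : 6 ≤ s) (T : Finset ℕ) (hT : ∀ p ∈ T, p.Prime) :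
    ∏ p ∈ T, p ^ (if p = s ∨ p + 1 = s then 1 else 0) ≤ s := by
  have h1 : ∀ p ∈ T, p ^ (if p = s ∨ p + 1 = s then 1 else 0) =
      if p = s ∨ p + 1 = s then p else 1 := by
    intro p _
    split_ifs <;> simp
  rw [Finset.prod_congr rfl h1, ← Finset.prod_filter]
  obtain ⟨q, hq, hqs, hq0⟩ : ∃ q, (∀ p ∈ T, p = s ∨ p + 1 = s → p = q) ∧ q ≤ s ∧ 1 ≤ q := by
    by_cases hsp : s.Prime
    · refine ⟨s, fun p hp h => ?_, le_rfl, by omega⟩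
      rcases h with h | h
      · exact h
      · have h2 := hsp.eq_two_or_odd
        have h3 := (hT p hp).eq_two_or_odd
        omega
    · refine ⟨s - 1, fun p hp h => ?_, by omega, by omega⟩
      rcases h with h | h
      · exact absurd (h ▸ hT p hp) hsp
      · omega
  refine le_trans (Finset.prod_le_prod_of_subset_of_one_le' (t := {q}) ?_ ?_) (by simpa using hqs)
  · intro p hp
    rw [Finset.mem_filter] at hp
    simpa using hq p hp.1 hp.2
  · intro p hp _
    rw [Finset.mem_singleton] at hp
    omega

theorem prod_pow_factorization_le {m : ℕ} (hm : m ≠ 0) (T : Finset ℕ) (hT : ∀ p ∈ T, p.Prime) :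
    ∏ p ∈ T, p ^ m.factorization p ≤ m := by
  refine Nat.le_of_dvd (Nat.pos_of_ne_zero hm) (Finset.prod_dvd_of_isRelPrime ?_ fun p _ =>
    Nat.ordProj_dvd m p)
  intro p hp q hq hpq
  rw [Function.onFun, ← Nat.coprime_iff_isRelPrime]
  exact Nat.Coprime.pow _ _ ((Nat.coprime_primes (hT p hp) (hT q hq)).2 hpq)

theorem card_primes_le_eq_primePi {s : ℕ} {b : ℝ} (hb : b ≤ s) :
    ((Finset.range (s + 1)).filter fun p : ℕ => p.Prime ∧ (p : ℝ) ≤ b).card = primePi b := by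
  unfold primePi
  rw [Nat.primeCounting, Nat.primeCounting', Nat.count_eq_card_filter_range]
  congr 1
  ext p
  simp only [Finset.mem_filter, Finset.mem_range]
  constructor
  · rintro ⟨-, hp, hpb⟩
    exact ⟨Nat.lt_succ_of_le ((Nat.le_floor_iff' hp.ne_zero).2 hpb), hp⟩
  · rintro ⟨hpb, hp⟩
    have h1 := (Nat.le_floor_iff' hp.ne_zero).1 (Nat.le_of_lt_succ hpb)
    exact ⟨Nat.lt_succ_of_le (by exact_mod_cast h1.trans hb), hp, h1⟩

namespace IsAdmissible

variable {s K L I : ℕ}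

/-- The denominator of the test quotient is at most its numerator times the contributions of the
primes up to `s`. -/
theorem denominator_le (h : IsAdmissible s K L) (hI : 2 ≤ I) (hs : 2 * I + 2 ≤ s)
    (hn : 4 * I ≤ K + L + 1) {b : ℝ} (hb : b ≤ s) :
    (((K + L + 1).ascFactorial (2 * I + 1) * (K + L + 1).ascFactorial I : ℕ) : ℝ) ≤
      ((K.ascFactorial (I + 1) * L.ascFactorial (I + 1) : ℕ) : ℝ) *
      (((3 / 2 * ((K + L + 1 : ℕ) : ℝ)) ^ 2) ^ primePi b *
        (((2 * I).choose (I + 1) * (I - 1)! : ℕ) : ℝ) *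
        ((∏ p ∈ primesIoc b s, (p : ℝ) ^ padicValNat p (Ftilde s (2 * I + 2))) * s)) := by
  classical
  have hK0 := h.K_pos
  have hL0 := h.L_pos
  set n := K + L + 1 with hndef
  set Y := n.ascFactorial (2 * I + 1) * n.ascFactorial I with hY
  set X := K.ascFactorial (I + 1) * L.ascFactorial (I + 1) with hX
  set M := (2 * I).choose (I + 1) * (I - 1)! with hM
  have hY0 : Y ≠ 0 := mul_ne_zero (ascFactorial_ne_zero (by omega) _)
    (ascFactorial_ne_zero (by omega) _)
  have hX0 : X ≠ 0 := mul_ne_zero (ascFactorial_ne_zero (by omega) _)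
    (ascFactorial_ne_zero (by omega) _)
  have hM0 : M ≠ 0 := mul_ne_zero (Nat.choose_pos (by omega)).ne' (Nat.factorial_ne_zero _)
  have hYf : ∀ p, Y.factorization p = (n.ascFactorial (2 * I + 1)).factorization p +
      (n.ascFactorial I).factorization p := fun p => by
    rw [hY, Nat.factorization_mul (ascFactorial_ne_zero (by omega) _)
      (ascFactorial_ne_zero (by omega) _), Finsupp.add_apply]
  have hXf : ∀ p, X.factorization p = (K.ascFactorial (I + 1)).factorization p +
      (L.ascFactorial (I + 1)).factorization p := fun p => by
    rw [hX, Nat.factorization_mul (ascFactorial_ne_zero (by omega) _)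
      (ascFactorial_ne_zero (by omega) _), Finsupp.add_apply]
  set S := (Finset.range (s + 1)).filter Nat.Prime with hS
  set D := ∏ p ∈ S, p ^ (Y.factorization p - X.factorization p) with hD
  have hSprime : ∀ p ∈ S, p.Prime := fun p hp => (Finset.mem_filter.1 hp).2
  have hD0 : D ≠ 0 := Finset.prod_ne_zero_iff.2 fun p hp => pow_ne_zero _ (hSprime p hp).ne_zero
  have hdvd : Y ∣ X * D := by
    rw [← Nat.factorization_prime_le_iff_dvd hY0 (mul_ne_zero hX0 hD0)]
    intro p hp
    rw [Nat.factorization_mul hX0 hD0, Finsupp.add_apply]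
    rcases Nat.lt_or_ge s p with hsp | hps
    · have h1 := h.factorization_le hp hI hs
      have h2 : valLoss p s = 0 := by
        unfold valLoss
        rw [if_neg (by omega), Nat.log_of_lt (by omega), Nat.log_of_lt (by omega)]
      rw [Nat.factorization_factorial_eq_zero_of_lt hsp,
        Nat.factorization_factorial_eq_zero_of_lt (by omega), h2, ← hYf, ← hXf] at h1
      omega
    · have h1 : p ^ (Y.factorization p - X.factorization p) ∣ D :=
        Finset.dvd_prod_of_mem (fun p => p ^ (Y.factorization p - X.factorization p))
          (Finset.mem_filter.2 ⟨Finset.mem_range.2 (by omega), hp⟩)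
      have h2 := (hp.pow_dvd_iff_le_factorization hD0).1 h1
      omega
  have hle : Y ≤ X * D := Nat.le_of_dvd (Nat.pos_of_ne_zero (mul_ne_zero hX0 hD0)) hdvd
  set S1 := (Finset.range (s + 1)).filter (fun p : ℕ => p.Prime ∧ (p : ℝ) ≤ b) with hS1
  have hsplit : D = (∏ p ∈ S1, p ^ (Y.factorization p - X.factorization p)) *
      ∏ p ∈ primesIoc b s, p ^ (Y.factorization p - X.factorization p) := by
    rw [hD, ← Finset.prod_filter_mul_prod_filter_not S (fun p => (p : ℝ) ≤ b), hS,
      Finset.filter_filter, Finset.filter_filter]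
    simp only [not_le, hS1, primesIoc]
  have hnreal : (4 : ℝ) * I ≤ (n : ℝ) := by exact_mod_cast hn
  have hbound1 : ((∏ p ∈ S1, p ^ (Y.factorization p - X.factorization p) : ℕ) : ℝ) ≤
      ((3 / 2 * (n : ℝ)) ^ 2) ^ primePi b * (M : ℝ) := by
    have hS1prime : ∀ p ∈ S1, p.Prime := fun p hp => (Finset.mem_filter.1 hp).2.1
    have hterm : ∀ p ∈ S1, ((p : ℝ)) ^ (Y.factorization p - X.factorization p) ≤
        (3 / 2 * (n : ℝ)) ^ 2 * (p : ℝ) ^ M.factorization p := by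
      intro p hp
      have hpp := hS1prime p hp
      obtain ⟨a, a', ha, ha', hval⟩ :=
        exists_factorization_le (n := n) hpp (by omega) hK0 hL0 hI
      rw [← hYf, ← hXf, ← hM] at hval
      have h1 : (1 : ℝ) ≤ p := by exact_mod_cast hpp.one_le
      calc (p : ℝ) ^ (Y.factorization p - X.factorization p)
          ≤ (p : ℝ) ^ (a + a' + M.factorization p) := pow_le_pow_right₀ h1 (by omega)
        _ = ((p : ℝ) ^ a * (p : ℝ) ^ a') * (p : ℝ) ^ M.factorization p := by
            rw [pow_add, pow_add]
        _ ≤ _ := by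
            refine mul_le_mul_of_nonneg_right ?_ (by positivity)
            rw [pow_two]
            refine mul_le_mul ?_ ?_ (by positivity) (by positivity)
            · have : ((p : ℝ)) ^ a ≤ n + 2 * I := by exact_mod_cast ha
              linarith
            · have : ((p : ℝ)) ^ a' ≤ n + (I - 1 : ℕ) := by exact_mod_cast ha'
              rw [Nat.cast_sub (by omega)] at this
              push_cast at this
              have : (0 : ℝ) ≤ I := Nat.cast_nonneg _
              linarith
    have h2 := prod_pow_factorization_le hM0 S1 hS1prime
    have h3 : (∏ p ∈ S1, (p : ℝ) ^ M.factorization p) ≤ M := by exact_mod_cast h2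
    push_cast
    refine (Finset.prod_le_prod (fun p _ => by positivity) hterm).trans ?_
    rw [Finset.prod_mul_distrib, Finset.prod_const, card_primes_le_eq_primePi hb]
    exact mul_le_mul_of_nonneg_left h3 (by positivity)
  have hbound2 : ((∏ p ∈ primesIoc b s, p ^ (Y.factorization p - X.factorization p) : ℕ) : ℝ) ≤
      (∏ p ∈ primesIoc b s, (p : ℝ) ^ padicValNat p (Ftilde s (2 * I + 2))) * s := by
    have hprime : ∀ p ∈ primesIoc b s, p.Prime := fun p hp => (Finset.mem_filter.1 hp).2.1
    have h1 : ∏ p ∈ primesIoc b s, p ^ (Y.factorization p - X.factorization p) ≤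
        (∏ p ∈ primesIoc b s, p ^ padicValNat p (Ftilde s (2 * I + 2))) * s := by
      refine le_trans ?_ (Nat.mul_le_mul_left _ (prod_pow_ite_le (by omega) _ hprime))
      rw [← Finset.prod_mul_distrib]
      refine Finset.prod_le_prod' fun p hp => ?_
      rw [← pow_add]
      refine Nat.pow_le_pow_right (hprime p hp).pos ?_
      have h2 := h.factorization_le (hprime p hp) hI hs
      have h3 := valLoss_add_le (r := 2 * I + 2) (hprime p hp) (show 3 ≤ s by omega)
      rw [← hYf, ← hXf] at h2
      omega
    exact_mod_cast h1
  calc (Y : ℝ) ≤ (X : ℝ) * (D : ℝ) := by exact_mod_cast hle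
    _ ≤ _ := by
      refine mul_le_mul_of_nonneg_left ?_ (by positivity)
      rw [hsplit, Nat.cast_mul]
      exact mul_le_mul hbound1 hbound2 (by positivity) (by positivity)

/-- Comparison of the upper and the lower bound for the test quotient, after taking logarithms. -/
theorem psi_mul_log_le (h : IsAdmissible s K L) (hI : 2 ≤ I) (hs : 2 * I + 2 ≤ s)
    (hn : 4 * I ≤ K + L + 1) {b : ℝ} (hb : b ≤ s) :
    psi (2 * I + 2) b * Real.log ((K + L + 1 : ℕ) : ℝ) ≤ kappa s (2 * I + 2) b := by
  have hden := h.denominator_le hI hs hn hb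
  have hamgm := pow_mul_four_pow_mul_le K L (show 1 ≤ I by omega)
  have hK0 := h.K_pos
  have hL0 := h.L_pos
  obtain ⟨g, rfl⟩ : ∃ g, s = 2 * I + 2 + g := ⟨s - (2 * I + 2), by omega⟩
  have hconst := choose_mul_factorial_mul_le I g hI
  set s := 2 * I + 2 + g with hsdef
  set n := K + L + 1 with hndef
  set X := K.ascFactorial (I + 1) * L.ascFactorial (I + 1) with hX
  set M := (2 * I).choose (I + 1) * (I - 1)! with hM
  set P := ∏ p ∈ primesIoc b s, (p : ℝ) ^ padicValNat p (Ftilde s (2 * I + 2)) with hP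
  have hprime : ∀ p ∈ primesIoc b s, p.Prime := fun p hp => (Finset.mem_filter.1 hp).2.1
  have hX0 : (0 : ℝ) < X := by
    exact_mod_cast Nat.pos_of_ne_zero (mul_ne_zero (ascFactorial_ne_zero (by omega) _)
      (ascFactorial_ne_zero (by omega) _))
  have hn0 : (0 : ℝ) < n := by exact_mod_cast Nat.succ_pos _
  have hP0 : 0 < P := Finset.prod_pos fun p hp => pow_pos (by exact_mod_cast (hprime p hp).pos) _
  have e1 : 2 * s - 3 * (2 * I + 2) / 2 + 2 = I + 3 + 2 * g := by omega
  have e2 : 2 * s - (2 * I + 2) + 2 = 2 * (I + 2 + g) := by omega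
  have e3 : s - (2 * I + 2) + 1 = g + 1 := by omega
  have e4 : s - (2 * I + 2) / 2 + 1 = I + 2 + g := by omega
  set C : ℝ := (((2 * s - 3 * (2 * I + 2) / 2 + 2)! : ℕ) : ℝ) * ((s ! : ℕ) : ℝ) /
    ((((2 * s - (2 * I + 2) + 2)! : ℕ) : ℝ) * (((s - (2 * I + 2) + 1)! : ℕ) : ℝ) *
      ((s - (2 * I + 2) / 2 + 1 : ℕ) : ℝ)) with hC
  have hC0 : 0 < C := by
    rw [hC, e4]
    have : (0 : ℝ) < ((I + 2 + g : ℕ) : ℝ) := by exact_mod_cast (by omega : 0 < I + 2 + g)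
    positivity
  have hMC : (M : ℝ) * s ≤ C * 2 ^ s := by
    rw [hC, e1, e2, e3, e4, div_mul_eq_mul_div, le_div_iff₀]
    · have hfac : s ! = s * (2 * I + 1 + g)! := by
        rw [hsdef, show 2 * I + 2 + g = 2 * I + 1 + g + 1 by ring, Nat.factorial_succ]
      have h1 : M * s * ((2 * (I + 2 + g))! * (g + 1)! * (I + 2 + g)) ≤
          (I + 3 + 2 * g)! * s ! * 2 ^ s := by
        rw [hfac]
        calc M * s * ((2 * (I + 2 + g))! * (g + 1)! * (I + 2 + g))
            = M * ((2 * (I + 2 + g))! * (g + 1)! * (I + 2 + g)) * s := by ring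
          _ ≤ _ := Nat.mul_le_mul_right s hconst
          _ = _ := by ring
      exact_mod_cast h1
    · have : (0 : ℝ) < ((I + 2 + g : ℕ) : ℝ) := by exact_mod_cast (by omega : 0 < I + 2 + g)
      positivity
  have key : (n : ℝ) ^ (I - 1) * 4 ^ (I + 1) ≤
      ((3 / 2 * (n : ℝ)) ^ 2) ^ primePi b * (C * 2 ^ s) * P := by
    have h1 : (n : ℝ) ^ (I - 1) * 4 ^ (I + 1) * X ≤
        ((3 / 2 * (n : ℝ)) ^ 2) ^ primePi b * (C * 2 ^ s) * P * X := by
      calc (n : ℝ) ^ (I - 1) * 4 ^ (I + 1) * X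
          ≤ ((n.ascFactorial (2 * I + 1) * n.ascFactorial I : ℕ) : ℝ) := by exact_mod_cast hamgm
        _ ≤ _ := hden
        _ = ((3 / 2 * (n : ℝ)) ^ 2) ^ primePi b * ((M : ℝ) * s) * P * X := by ring
        _ ≤ _ := by gcongr
    exact le_of_mul_le_mul_right h1 hX0
  have hlog := Real.log_le_log (by positivity) key
  have hlogP : Real.log P =
      ∑ p ∈ primesIoc b s, (padicValNat p (Ftilde s (2 * I + 2)) : ℝ) * Real.log p := by
    rw [hP, Real.log_prod fun p hp => pow_ne_zero _ (by exact_mod_cast (hprime p hp).ne_zero)]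
    exact Finset.sum_congr rfl fun p _ => Real.log_pow _ _
  rw [Real.log_mul (by positivity) (by positivity), Real.log_mul (by positivity) hP0.ne',
    Real.log_mul (by positivity) (by positivity), Real.log_mul hC0.ne' (by positivity),
    Real.log_pow, Real.log_pow, Real.log_pow, Real.log_pow, Real.log_pow,
    Real.log_mul (by norm_num) hn0.ne', hlogP, show (4 : ℝ) = 2 ^ 2 by norm_num,
    Real.log_pow, Nat.cast_sub (by omega : 1 ≤ I)] at hlog
  unfold psi kappa
  rw [← hC]
  have hcast : (s : ℝ) = 2 * I + 2 + g := by rw [hsdef]; push_cast; ring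
  push_cast at hlog ⊢
  nlinarith [hlog]

end IsAdmissible

/-! ### Families of `k`-sets with constant inclusion numbers -/

/-- The number of members of `B` that contain `I` and are disjoint from `J`. -/
def blockCount {V : Type*} [DecidableEq V] (B : Finset (Finset V)) (I J : Finset V) : ℕ :=
  (B.filter fun A => I ⊆ A ∧ Disjoint J A).card

/-- A family of `k`-subsets of a `v`-set that is regular of strength `t` with density `ρ`: the
number of members that contain `I` and avoid `J` depends only on the sizes of the disjoint sets
`I` and `J`, as long as these add up to at most `t`, and is `ρ` times the number of all `k`-sets
with this property. -/
structure IsRegularFamily {V : Type*} [Fintype V] [DecidableEq V] (t k : ℕ) (ρ : ℚ)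
    (B : Finset (Finset V)) : Prop where
  card_block : ∀ A ∈ B, A.card = k
  count : ∀ I J : Finset V, Disjoint I J → I.card + J.card ≤ t →
    (blockCount B I J : ℚ) = ρ * (Fintype.card V - I.card - J.card).choose (k - I.card)

section Counting

variable {V : Type*} [DecidableEq V]

theorem sum_blockCount_insert [Fintype V] {B : Finset (Finset V)} {k : ℕ}
    (hB : ∀ A ∈ B, A.card = k) (I : Finset V) :
    ∑ x ∈ Iᶜ, blockCount B (insert x I) ∅ = (k - I.card) * blockCount B I ∅ := by
  have h1 : ∀ x ∈ Iᶜ, blockCount B (insert x I) ∅ =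
      ∑ A ∈ B.filter fun A => I ⊆ A, if x ∈ A then 1 else 0 := by
    intro x _
    rw [← Finset.card_filter, Finset.filter_filter, blockCount]
    congr 1
    ext A
    simp [Finset.insert_subset_iff, and_comm]
  rw [Finset.sum_congr rfl h1, Finset.sum_comm]
  have h2 : ∀ A ∈ B.filter (fun A => I ⊆ A), ∑ x ∈ Iᶜ, (if x ∈ A then 1 else 0) = k - I.card := by
    intro A hA
    rw [Finset.mem_filter] at hA
    rw [← Finset.card_filter, ← hB A hA.1, ← Finset.card_sdiff_of_subset hA.2]
    congr 1
    ext x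
    simp [and_comm]
  rw [Finset.sum_congr rfl h2, Finset.sum_const, smul_eq_mul, mul_comm, blockCount]
  simp

theorem blockCount_eq_add (B : Finset (Finset V)) (I J : Finset V) (x : V) :
    blockCount B I J = blockCount B I (insert x J) + blockCount B (insert x I) J := by
  unfold blockCount
  rw [← Finset.card_filter_add_card_filter_not (s := B.filter fun A => I ⊆ A ∧ Disjoint J A)
    (fun A => x ∉ A), Finset.filter_filter, Finset.filter_filter]
  congr 2
  · ext A
    simp only [Finset.mem_filter, Finset.disjoint_insert_left]
    tauto
  · ext A
    simp only [Finset.mem_filter, Finset.insert_subset_iff, not_not]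
    tauto

/-- The counts for the pairs `(I, ∅)` determine all others, by Pascal's rule. -/
theorem IsRegularFamily.of_count_empty [Fintype V] {t k : ℕ} {ρ : ℚ} {B : Finset (Finset V)}
    (hB : ∀ A ∈ B, A.card = k) (htk : t ≤ k) (hkv : k ≤ Fintype.card V)
    (h : ∀ I : Finset V, I.card ≤ t →
      (blockCount B I ∅ : ℚ) = ρ * (Fintype.card V - I.card).choose (k - I.card)) :
    IsRegularFamily t k ρ B := by
  refine ⟨hB, fun I J => ?_⟩
  induction J using Finset.induction_on generalizing I with
  | empty =>
    intro _ hI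
    rw [h I (by simpa using hI)]
    simp
  | insert x J hx ih =>
    intro hIJ hcard
    rw [Finset.disjoint_insert_right] at hIJ
    rw [Finset.card_insert_of_notMem hx] at hcard ⊢
    have h1 := ih I hIJ.2 (by omega)
    have hcI : (insert x I).card = I.card + 1 := Finset.card_insert_of_notMem hIJ.1
    have h2 := ih (insert x I) (by simp [hx, hIJ.2]) (by omega)
    rw [hcI] at h2
    rw [blockCount_eq_add B I J x] at h1
    push_cast at h1
    obtain ⟨m, hm⟩ : ∃ m, Fintype.card V - I.card - J.card = m + 1 :=
      ⟨Fintype.card V - I.card - J.card - 1, by omega⟩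
    obtain ⟨q, hq⟩ : ∃ q, k - I.card = q + 1 := ⟨k - I.card - 1, by omega⟩
    rw [show Fintype.card V - (I.card + 1) - J.card = m by omega,
      show k - (I.card + 1) = q by omega] at h2
    rw [hm, hq, Nat.choose_succ_succ, h2] at h1
    rw [show Fintype.card V - I.card - (J.card + 1) = m by omega, hq]
    push_cast at h1
    linarith

/-- A `t`-design is a regular family of strength `t`. -/
theorem IsDesign.isRegularFamily [Fintype V] {t v k l : ℕ} {B : Finset (Finset V)}
    (h : IsDesign t v k l B) (htk : t ≤ k) (hkv : k ≤ v) :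
    IsRegularFamily t k ((l : ℚ) / (v - t).choose (k - t)) B := by
  refine IsRegularFamily.of_count_empty h.card_block htk (h.card_points ▸ hkv) ?_
  rw [h.card_points]
  set ρ : ℚ := (l : ℚ) / (v - t).choose (k - t) with hρ
  have hmain : ∀ d, ∀ I : Finset V, I.card + d = t →
      (blockCount B I ∅ : ℚ) = ρ * (v - I.card).choose (k - I.card) := by
    intro d
    induction d with
    | zero =>
      intro I hI
      have hpos : (0 : ℚ) < (v - t).choose (k - t) := by
        exact_mod_cast Nat.choose_pos (by omega)
      rw [show I.card = t by omega, hρ, div_mul_cancel₀ _ hpos.ne', ← h.card_cover I (by omega)]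
      simp [blockCount]
    | succ d ih =>
      intro I hI
      have h1 := sum_blockCount_insert h.card_block I
      have h2 : ∀ x ∈ Iᶜ, (blockCount B (insert x I) ∅ : ℚ) =
          ρ * (v - I.card - 1).choose (k - I.card - 1) := by
        intro x hx
        have hc : (insert x I).card = I.card + 1 :=
          Finset.card_insert_of_notMem (by simpa using hx)
        rw [ih _ (by omega), hc, Nat.sub_add_eq, Nat.sub_add_eq]
      have h3 : (∑ x ∈ Iᶜ, (blockCount B (insert x I) ∅ : ℚ)) =
          ((k - I.card : ℕ) : ℚ) * blockCount B I ∅ := by exact_mod_cast h1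
      rw [Finset.sum_congr rfl h2, Finset.sum_const, Finset.card_compl, h.card_points,
        nsmul_eq_mul] at h3
      obtain ⟨m, hm⟩ : ∃ m, v - I.card = m + 1 := ⟨v - I.card - 1, by omega⟩
      obtain ⟨q, hq⟩ : ∃ q, k - I.card = q + 1 := ⟨k - I.card - 1, by omega⟩
      rw [hm, hq, Nat.add_sub_cancel, Nat.add_sub_cancel] at h3
      rw [hm, hq]
      have h4 : ((m + 1 : ℕ) : ℚ) * m.choose q = (m + 1).choose (q + 1) * ((q + 1 : ℕ) : ℚ) := by
        exact_mod_cast Nat.add_one_mul_choose_eq m q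
      have h5 : ((q + 1 : ℕ) : ℚ) ≠ 0 := by positivity
      refine mul_left_cancel₀ h5 ?_
      rw [← h3]
      linear_combination ρ * h4
  exact fun I hI => hmain (t - I.card) I (by omega)

theorem isRegularFamily_powersetCard [Fintype V] {t k : ℕ} (htk : t ≤ k)
    (hkv : k ≤ Fintype.card V) :
    IsRegularFamily t k 1 ((Finset.univ : Finset V).powersetCard k) := by
  refine IsRegularFamily.of_count_empty (fun A hA => (Finset.mem_powersetCard.1 hA).2) htk hkv ?_
  intro I hI
  rw [one_mul, Nat.cast_inj, ← Finset.card_compl, ← Finset.card_powersetCard, blockCount]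
  refine Finset.card_bij' (fun A _ => A \ I) (fun A _ => A ∪ I) ?_ ?_ ?_ ?_
  · intro A hA
    simp only [Finset.mem_filter, Finset.mem_powersetCard] at hA
    rw [Finset.mem_powersetCard, Finset.card_sdiff_of_subset hA.2.1, hA.1.2]
    exact ⟨fun x hx => by simpa using (Finset.mem_sdiff.1 hx).2, rfl⟩
  · intro A hA
    rw [Finset.mem_powersetCard] at hA
    have hd : Disjoint A I := Finset.disjoint_left.2 fun x hx => by simpa using hA.1 hx
    simp only [Finset.mem_filter, Finset.mem_powersetCard, Finset.card_union_of_disjoint hd]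
    exact ⟨⟨Finset.subset_univ _, by omega⟩, Finset.subset_union_right,
      Finset.disjoint_empty_left _⟩
  · intro A hA
    simp only [Finset.mem_filter] at hA
    exact Finset.sdiff_union_of_subset hA.2.1
  · intro A hA
    rw [Finset.mem_powersetCard] at hA
    have hd : Disjoint A I := Finset.disjoint_left.2 fun x hx => by simpa using hA.1 hx
    exact Finset.union_sdiff_cancel_right hd

end Counting

namespace IsRegularFamily

variable {V : Type*} [Fintype V] [DecidableEq V] {t k : ℕ} {ρ : ℚ} {B : Finset (Finset V)}

/-- Double counting of the `a`-subsets of `Q` that avoid a block containing `S`. -/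
theorem sum_choose_card_sdiff (h : IsRegularFamily t k ρ B) (Q S : Finset V) {a : ℕ}
    (ha : S.card + a ≤ t) :
    ∑ A ∈ B.filter (fun A => S ⊆ A), ((Q \ A).card.choose a : ℚ) =
      (Q \ S).card.choose a * (ρ * (Fintype.card V - S.card - a).choose (k - S.card)) := by
  have hpow : ∀ A : Finset V,
      (Q \ A).powersetCard a = (Q.powersetCard a).filter fun T => Disjoint T A := by
    intro A
    ext T
    simp only [Finset.mem_filter, Finset.mem_powersetCard, Finset.subset_sdiff]
    tauto
  have h1 : ∀ A : Finset V, ((Q \ A).card.choose a : ℚ) =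
      ∑ T ∈ Q.powersetCard a, if Disjoint T A then 1 else 0 := by
    intro A
    rw [← Finset.card_powersetCard, hpow, Finset.card_filter]
    push_cast
    rfl
  rw [Finset.sum_congr rfl fun A _ => h1 A, Finset.sum_comm]
  have h2 : ∀ T ∈ Q.powersetCard a,
      (∑ A ∈ B.filter (fun A => S ⊆ A), if Disjoint T A then (1 : ℚ) else 0) =
        (if Disjoint T S then 1 else 0) *
          (ρ * (Fintype.card V - S.card - a).choose (k - S.card)) := by
    intro T hT
    rw [← Finset.sum_filter, Finset.filter_filter, Finset.sum_const, nsmul_one]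
    change (blockCount B S T : ℚ) = _
    split_ifs with hd
    · rw [h.count S T hd.symm (by rw [(Finset.mem_powersetCard.1 hT).2]; exact ha),
        (Finset.mem_powersetCard.1 hT).2, one_mul]
    · rw [zero_mul, Nat.cast_eq_zero, blockCount, Finset.card_eq_zero,
        Finset.filter_eq_empty_iff]
      exact fun A _ hA => hd (hA.2.mono_right hA.1)
  rw [Finset.sum_congr rfl h2, ← Finset.sum_mul, ← h1]

/-- Design identity: a combination of the functions `z ↦ z.choose a` with `a ≤ t` has the same
average over a regular family as over all `k`-sets. -/
theorem sum_eq_sum_powersetCard (h : IsRegularFamily t k ρ B) (htk : t ≤ k)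
    (hkv : k ≤ Fintype.card V) (Q : Finset V) (g : ℕ → ℚ) :
    ∑ A ∈ B, ∑ a ∈ Finset.range (t + 1), g a * (Q \ A).card.choose a =
      ρ * ∑ A ∈ (Finset.univ : Finset V).powersetCard k,
        ∑ a ∈ Finset.range (t + 1), g a * (Q \ A).card.choose a := by
  have key : ∀ {ρ' : ℚ} {B' : Finset (Finset V)}, IsRegularFamily t k ρ' B' →
      ∑ A ∈ B', ∑ a ∈ Finset.range (t + 1), g a * ((Q \ A).card.choose a : ℚ) =
      ρ' * ∑ a ∈ Finset.range (t + 1),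
        g a * (Q.card.choose a * (Fintype.card V - a).choose k) := by
    intro ρ' B' h'
    rw [Finset.sum_comm, Finset.mul_sum]
    refine Finset.sum_congr rfl fun a ha => ?_
    have h1 := h'.sum_choose_card_sdiff Q ∅ (a := a)
      (by simpa [Nat.lt_succ_iff] using ha)
    simp only [Finset.empty_subset, Finset.filter_true, Finset.sdiff_empty, Finset.card_empty,
      Nat.sub_zero] at h1
    rw [← Finset.mul_sum, h1]
    ring
  rw [key h, key (isRegularFamily_powersetCard htk hkv), one_mul]

end IsRegularFamily

/-! ### Expansions in binomial coefficients -/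

/-- Vandermonde convolution of `(1 + x) ^ y` and `(1 + x) ^ (-(K + 1))`. -/
theorem sum_neg_one_pow_mul_choose_mul_choose (s K y : ℕ) :
    ∑ a ∈ Finset.range (s + 1), (-1 : ℤ) ^ (s - a) * (K + (s - a)).choose (s - a) * y.choose a =
      Ring.choose ((y : ℤ) - (K + 1)) s := by
  rw [sub_eq_add_neg, Ring.add_choose_eq s (Commute.all _ _),
    Finset.Nat.sum_antidiagonal_eq_sum_range_succ_mk]
  refine Finset.sum_congr rfl fun a _ => ?_
  simp only
  have h1 : ((K : ℤ) + 1 + ((s - a : ℕ) : ℤ) - 1) = ((K + (s - a) : ℕ) : ℤ) := by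
    push_cast; ring
  rw [Ring.choose_neg, h1, Ring.choose_natCast, Ring.choose_natCast, Int.negOnePow_def,
    Units.smul_def, zpow_natCast]
  push_cast
  rw [smul_eq_mul]
  ring

theorem sum_neg_one_pow_mul_choose_mul_choose_self (s K : ℕ) :
    ∑ a ∈ Finset.range (s + 1), (-1 : ℤ) ^ (s - a) * (K + (s - a)).choose (s - a) * K.choose a =
      (-1) ^ s := by
  rw [sum_neg_one_pow_mul_choose_mul_choose, show (K : ℤ) - (K + 1) = -((1 : ℕ) : ℤ) by
    push_cast; ring, Ring.choose_neg, Int.negOnePow_def, Units.smul_def, zpow_natCast,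
    show (((1 : ℕ) : ℤ) + (s : ℤ) - 1) = (s : ℤ) by push_cast; ring, Ring.choose_natCast]
  simp

theorem sum_neg_one_pow_mul_choose_mul_choose_of_lt {s K y : ℕ} (h1 : K < y) (h2 : y ≤ K + s) :
    ∑ a ∈ Finset.range (s + 1), (-1 : ℤ) ^ (s - a) * (K + (s - a)).choose (s - a) * y.choose a =
      0 := by
  rw [sum_neg_one_pow_mul_choose_mul_choose, show (y : ℤ) - (K + 1) = ((y - (K + 1) : ℕ) : ℤ) by
    rw [Nat.cast_sub (by omega)]; push_cast; ring, Ring.choose_natCast,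
    Nat.choose_eq_zero_of_lt (by omega), Nat.cast_zero]

/-- A combination of `m` binomial coefficients `z.choose a`, `a < m`, is a polynomial in `z` of
degree less than `m`; it vanishes identically if it has `m` zeros, and then its coefficients
vanish. -/
theorem eq_zero_of_sum_mul_choose_eq_zero {g : ℕ → ℚ} {m : ℕ} {Z : Finset ℕ} (hm : m ≤ Z.card)
    (hZ : ∀ z ∈ Z, ∑ a ∈ Finset.range m, g a * (z.choose a : ℚ) = 0) :
    ∀ a < m, g a = 0 := by
  rcases Nat.eq_zero_or_pos m with rfl | hm0
  · simp
  set p : Polynomial ℚ := ∑ a ∈ Finset.range m, Polynomial.C (g a / a !) * descPochhammer ℚ a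
    with hp
  have heval : ∀ z : ℕ, p.eval (z : ℚ) = ∑ a ∈ Finset.range m, g a * (z.choose a : ℚ) := by
    intro z
    rw [hp, Polynomial.eval_finsetSum]
    refine Finset.sum_congr rfl fun a _ => ?_
    have : ((a ! : ℕ) : ℚ) ≠ 0 := by exact_mod_cast Nat.factorial_ne_zero a
    rw [Polynomial.eval_mul, Polynomial.eval_C, descPochhammer_eval_eq_descFactorial,
      Nat.descFactorial_eq_factorial_mul_choose]
    push_cast
    field_simp
  have hdeg : p.natDegree < m := by
    refine lt_of_le_of_lt (Polynomial.natDegree_sum_le_of_forall_le (n := m - 1) _ _ ?_) (by omega)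
    intro a ha
    refine (Polynomial.natDegree_C_mul_le _ _).trans ?_
    rw [descPochhammer_natDegree]
    have := Finset.mem_range.1 ha
    omega
  have hp0 : p = 0 := by
    refine Polynomial.eq_zero_of_natDegree_lt_card_of_eval_eq_zero' p
      (Z.map Nat.castEmbedding) ?_ (by rw [Finset.card_map]; omega)
    intro i hi
    obtain ⟨z, hz, rfl⟩ := Finset.mem_map.1 hi
    rw [Nat.castEmbedding_apply, heval, hZ z hz]
  have hall : ∀ z : ℕ, ∑ a ∈ Finset.range m, g a * (z.choose a : ℚ) = 0 := by
    intro z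
    rw [← heval, hp0, Polynomial.eval_zero]
  intro a
  induction a using Nat.strong_induction_on with
  | _ a ih =>
    intro ha
    have h1 := hall a
    rw [Finset.sum_eq_single a] at h1
    · simpa using h1
    · intro c hc hca
      rcases Nat.lt_or_ge c a with h | h
      · rw [ih c h (Finset.mem_range.1 hc), zero_mul]
      · rw [Nat.choose_eq_zero_of_lt (by omega), Nat.cast_zero, mul_zero]
    · intro h
      exact absurd (Finset.mem_range.2 ha) h

/-- A monic polynomial with integer roots has integer coefficients in the basis of falling
factorials. -/
theorem exists_prod_sub_eq_sum_descFactorial (M : Multiset ℕ) :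
    ∃ e : ℕ → ℤ, e M.card = 1 ∧ ∀ z : ℕ, (M.map fun ζ : ℕ => (z : ℤ) - ζ).prod =
      ∑ a ∈ Finset.range (M.card + 1), e a * z.descFactorial a := by
  induction M using Multiset.induction_on with
  | empty => exact ⟨fun _ => 1, rfl, fun z => by simp⟩
  | cons ζ M ih =>
    obtain ⟨e, he, hz⟩ := ih
    refine ⟨fun a => (if a = 0 then 0 else e (a - 1)) +
      (if a ≤ M.card then e a * ((a : ℤ) - ζ) else 0), ?_, fun z => ?_⟩
    · simp [he]
    · rw [Multiset.map_cons, Multiset.prod_cons, hz, Multiset.card_cons, Finset.mul_sum]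
      simp only [add_mul]
      rw [Finset.sum_add_distrib, Finset.sum_range_succ' (n := M.card + 1),
        Finset.sum_range_succ (n := M.card + 1)
          (f := fun a => (if a ≤ M.card then e a * ((a : ℤ) - ζ) else 0) * _)]
      simp only [if_true, zero_mul, add_zero, Nat.add_sub_cancel, Nat.add_eq_zero_iff,
        one_ne_zero, and_false, if_false, Nat.not_succ_le_self]
      rw [← Finset.sum_add_distrib]
      refine Finset.sum_congr rfl fun a ha => ?_
      rw [if_pos (Nat.lt_succ_iff.1 (Finset.mem_range.1 ha)), Nat.descFactorial_succ]
      rcases Nat.lt_or_ge z a with h | h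
      · rw [Nat.descFactorial_of_lt h]
        simp
      · push_cast [Nat.cast_sub h]
        ring

theorem exists_prod_sub_eq_sum_choose (M : Multiset ℕ) {m : ℕ} (hM : M.card ≤ m) :
    ∃ g : ℕ → ℚ, ∀ z : ℕ, (((M.map fun ζ : ℕ => (z : ℤ) - ζ).prod : ℤ) : ℚ) =
      ∑ a ∈ Finset.range (m + 1), g a * z.choose a := by
  obtain ⟨e, -, he⟩ := exists_prod_sub_eq_sum_descFactorial M
  refine ⟨fun a => if a ≤ M.card then e a * a ! else 0, fun z => ?_⟩
  rw [he, ← Finset.sum_subset (Finset.range_mono (Nat.succ_le_succ hM))]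
  · push_cast
    refine Finset.sum_congr rfl fun a ha => ?_
    rw [if_pos (Nat.lt_succ_iff.1 (Finset.mem_range.1 ha)),
      Nat.descFactorial_eq_factorial_mul_choose]
    push_cast
    ring
  · intro a _ ha
    have ha' : ¬ a ≤ M.card := by simpa [Nat.lt_succ_iff] using ha
    simp only [if_neg ha', zero_mul]

/-! ### The incidence matrix of a tight design -/

/-- The set of values of `|A₀ \ A|` for the blocks `A` different from the block `A₀`. -/
def differenceSet {V : Type*} [DecidableEq V] (B : Finset (Finset V)) (A₀ : Finset V) : Finset ℕ :=
  (B.erase A₀).image fun A => (A₀ \ A).card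

namespace IsRegularFamily

variable {V : Type*} [Fintype V] [DecidableEq V] {s k : ℕ} {ρ : ℚ} {B : Finset (Finset V)}

/-- If a family of strength `2 s` has `(card V).choose s` members, then its incidence matrix with
the `s`-subsets is square and invertible: a function on the blocks is determined by its sums over
the blocks through each `s`-subset. -/
theorem eq_zero_of_sum_eq_zero (h : IsRegularFamily (2 * s) k ρ B) (hρ : 0 < ρ)
    (hsk : s ≤ k) (hkv : k + s ≤ Fintype.card V) (hcard : B.card = (Fintype.card V).choose s)
    {g : Finset V → ℚ}
    (hg : ∀ S : Finset V, S.card = s → ∑ A ∈ B.filter (fun A => S ⊆ A), g A = 0) :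
    ∀ A ∈ B, g A = 0 := by
  set lam : ℕ → ℚ := fun a => ρ * (Fintype.card V - s - a).choose (k - s) with hlam
  have hlam0 : ∀ a ≤ s, lam a ≠ 0 := by
    intro a ha
    have : (0 : ℚ) < (Fintype.card V - s - a).choose (k - s) := by
      exact_mod_cast Nat.choose_pos (by omega)
    exact (mul_pos hρ this).ne'
  set ι := {S // S ∈ (Finset.univ : Finset V).powersetCard s}
  set κ := {A // A ∈ B}
  set W : Matrix ι κ ℚ := Matrix.of fun S A => if S.1 ⊆ A.1 then 1 else 0 with hW
  set U : Matrix κ ι ℚ := Matrix.of fun A S =>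
    ∑ a ∈ Finset.range (s + 1), ((-1) ^ a / lam a) * ((S.1 \ A.1).card.choose a : ℚ) with hU
  have hWU : W * U = 1 := by
    ext S T
    have hS : S.1.card = s := (Finset.mem_powersetCard.1 S.2).2
    have hT : T.1.card = s := (Finset.mem_powersetCard.1 T.2).2
    have h1 : (W * U) S T = ∑ a ∈ Finset.range (s + 1), ((-1) ^ a / lam a) *
        ∑ A ∈ B.filter (fun A => S.1 ⊆ A), ((T.1 \ A).card.choose a : ℚ) := by
      rw [Matrix.mul_apply]
      simp only [hW, hU, Matrix.of_apply, ite_mul, one_mul, zero_mul]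
      rw [Finset.sum_coe_sort B (fun A => if S.1 ⊆ A then
        ∑ a ∈ Finset.range (s + 1), ((-1) ^ a / lam a) * ((T.1 \ A).card.choose a : ℚ) else 0),
        ← Finset.sum_filter, Finset.sum_comm]
      simp only [Finset.mul_sum]
    have h2 : (W * U) S T =
        ∑ a ∈ Finset.range (s + 1), ((-1) ^ a * ((T.1 \ S.1).card.choose a : ℚ)) := by
      rw [h1]
      refine Finset.sum_congr rfl fun a ha => ?_
      have ha' : a ≤ s := Nat.lt_succ_iff.1 (Finset.mem_range.1 ha)
      rw [h.sum_choose_card_sdiff T.1 S.1 (by omega), hS]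
      have := hlam0 a ha'
      change _ / lam a * (_ * lam a) = _
      field_simp
    have hle : (T.1 \ S.1).card ≤ s := (Finset.card_le_card Finset.sdiff_subset).trans hT.le
    rw [h2, ← Finset.sum_subset (Finset.range_mono (Nat.succ_le_succ hle))
      (fun a _ ha => by
        rw [Nat.choose_eq_zero_of_lt (by simpa [Nat.lt_succ_iff] using ha), Nat.cast_zero,
          mul_zero])]
    have h3 := Int.alternating_sum_range_choose (n := (T.1 \ S.1).card)
    have h4 : ∑ a ∈ Finset.range ((T.1 \ S.1).card + 1),
        ((-1 : ℚ) ^ a * ((T.1 \ S.1).card.choose a : ℚ)) =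
        if (T.1 \ S.1).card = 0 then 1 else 0 := by exact_mod_cast h3
    rw [h4, Matrix.one_apply]
    congr 1
    rw [Finset.card_eq_zero, Finset.sdiff_eq_empty_iff_subset, eq_iff_iff]
    exact ⟨fun hTS => Subtype.ext (Finset.eq_of_subset_of_card_le hTS (by omega)).symm,
      fun hST => by rw [hST]⟩
  have hUW : U * W = 1 := by
    refine (Matrix.mul_eq_one_comm_of_card_eq _ _ _ ?_).1 hWU
    simp only [ι, κ]
    rw [Fintype.card_coe, Fintype.card_coe, Finset.card_powersetCard, Finset.card_univ, hcard]
  have hWg : W.mulVec (fun A => g A.1) = 0 := by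
    ext S
    have hS : S.1.card = s := (Finset.mem_powersetCard.1 S.2).2
    rw [Matrix.mulVec, dotProduct]
    simp only [hW, Matrix.of_apply, ite_mul, one_mul, zero_mul]
    rw [Finset.sum_coe_sort B (fun A => if S.1 ⊆ A then g A else 0), ← Finset.sum_filter,
      hg S.1 hS]
    rfl
  have hzero : (fun A : κ => g A.1) = 0 := by
    rw [← Matrix.one_mulVec (fun A : κ => g A.1), ← hUW, ← Matrix.mulVec_mulVec, hWg,
      Matrix.mulVec_zero]
  exact fun A hA => congrFun hzero ⟨A, hA⟩

/-- The annihilator polynomial of the block differences of a tight design, in the basis of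
binomial coefficients. -/
theorem sum_mul_choose_eq_zero_of_mem_differenceSet (h : IsRegularFamily (2 * s) k ρ B)
    (hρ : 0 < ρ) (hsk : s ≤ k) (hkv : k + s ≤ Fintype.card V)
    (hcard : B.card = (Fintype.card V).choose s) {A₀ : Finset V} (hA₀ : A₀ ∈ B) {z : ℕ}
    (hz : z ∈ differenceSet B A₀) :
    ∑ a ∈ Finset.range (s + 1), ((-1) ^ (s - a) * (k - s + (s - a)).choose (s - a) /
      (ρ * (Fintype.card V - s - a).choose (k - s))) * (z.choose a : ℚ) = 0 := by
  obtain ⟨K, rfl⟩ : ∃ K, k = K + s := ⟨k - s, by omega⟩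
  rw [Nat.add_sub_cancel]
  set lam : ℕ → ℚ := fun a => ρ * (Fintype.card V - s - a).choose K with hlam
  have hlam0 : ∀ a ≤ s, lam a ≠ 0 := by
    intro a ha
    have : (0 : ℚ) < (Fintype.card V - s - a).choose K := by
      exact_mod_cast Nat.choose_pos (by omega)
    exact (mul_pos hρ this).ne'
  set F : ℕ → ℚ := fun z => ∑ a ∈ Finset.range (s + 1),
    ((-1) ^ (s - a) * (K + (s - a)).choose (s - a) / lam a) * (z.choose a : ℚ) with hF
  have hsum : ∀ S : Finset V, S.card = s →
      ∑ A ∈ B.filter (fun A => S ⊆ A), F (A₀ \ A).card = if S ⊆ A₀ then (-1) ^ s else 0 := by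
    intro S hS
    have h1 : ∑ A ∈ B.filter (fun A => S ⊆ A), F (A₀ \ A).card =
        ∑ a ∈ Finset.range (s + 1), (-1 : ℚ) ^ (s - a) * (K + (s - a)).choose (s - a) *
          ((A₀ \ S).card.choose a : ℚ) := by
      simp only [hF]
      rw [Finset.sum_comm]
      refine Finset.sum_congr rfl fun a ha => ?_
      have ha' : a ≤ s := Nat.lt_succ_iff.1 (Finset.mem_range.1 ha)
      rw [← Finset.mul_sum, h.sum_choose_card_sdiff A₀ S (by omega), hS, Nat.add_sub_cancel]
      have := hlam0 a ha'
      change _ / lam a * (_ * lam a) = _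
      field_simp
    have hA₀c := h.card_block A₀ hA₀
    rw [h1]
    split_ifs with hSA
    · have h2 : (A₀ \ S).card = K := by rw [Finset.card_sdiff_of_subset hSA]; omega
      rw [h2]
      exact_mod_cast sum_neg_one_pow_mul_choose_mul_choose_self s K
    · have h2 := Finset.card_sdiff_add_card_inter A₀ S
      have h3 : (A₀ ∩ S).card < s := by
        rw [← hS]
        refine Finset.card_lt_card ⟨Finset.inter_subset_right, fun hsub => hSA ?_⟩
        exact fun x hx => (Finset.mem_inter.1 (hsub hx)).1
      exact_mod_cast sum_neg_one_pow_mul_choose_mul_choose_of_lt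
        (show K < (A₀ \ S).card by omega) (show (A₀ \ S).card ≤ K + s by omega)
  obtain ⟨A, hA, rfl⟩ := Finset.mem_image.1 hz
  rw [Finset.mem_erase] at hA
  have h4 := h.eq_zero_of_sum_eq_zero hρ hsk hkv hcard
    (g := fun A => F (A₀ \ A).card - if A = A₀ then (-1) ^ s else 0) (fun S hS => by
      rw [Finset.sum_sub_distrib, hsum S hS, Finset.sum_ite_eq']
      simp [hA₀]) A hA.2
  simpa [hA.1] using h4

end IsRegularFamily

/-! ### The block differences of a tight design -/

section differenceSet

variable {V : Type*} [DecidableEq V] {k : ℕ} {B : Finset (Finset V)}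

theorem pos_of_mem_differenceSet (hB : ∀ A ∈ B, A.card = k) {A₀ : Finset V} (hA₀ : A₀ ∈ B) {z : ℕ}
    (hz : z ∈ differenceSet B A₀) : 0 < z := by
  obtain ⟨A, hA, rfl⟩ := Finset.mem_image.1 hz
  rw [Finset.mem_erase] at hA
  rw [Finset.card_pos, Finset.sdiff_nonempty]
  exact fun hsub => hA.1 (Finset.eq_of_subset_of_card_le hsub
    (by rw [hB A hA.2, hB A₀ hA₀])).symm

theorem le_of_mem_differenceSet [Fintype V] (hB : ∀ A ∈ B, A.card = k) {A₀ : Finset V} {z : ℕ}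
    (hz : z ∈ differenceSet B A₀) : z ≤ Fintype.card V - k := by
  obtain ⟨A, hA, rfl⟩ := Finset.mem_image.1 hz
  rw [Finset.mem_erase] at hA
  rw [← hB A hA.2, ← Finset.card_compl]
  refine Finset.card_le_card fun x hx => ?_
  simpa using (Finset.mem_sdiff.1 hx).2

end differenceSet

namespace IsRegularFamily

variable {V : Type*} [Fintype V] [DecidableEq V] {s t k : ℕ} {ρ : ℚ} {B : Finset (Finset V)}

/-- A polynomial of degree at most `t` that is nonnegative on `ℕ` and vanishes at all block
differences has average zero over the blocks, hence over all `k`-sets, so it vanishes at all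
differences of `k`-sets. -/
theorem mem_of_prod_nonneg (h : IsRegularFamily t k ρ B) (hρ : 0 < ρ) (htk : t ≤ k)
    (hkv : k ≤ Fintype.card V) {A₀ : Finset V} (hA₀ : A₀.card = k) {M : Multiset ℕ}
    (hM : M.card ≤ t) (hnn : ∀ z : ℕ, 0 ≤ (M.map fun ζ : ℕ => (z : ℤ) - ζ).prod)
    (hz : ∀ A ∈ B, (A₀ \ A).card ∈ M) {z : ℕ} (hzk : z ≤ k) (hzv : z ≤ Fintype.card V - k) :
    z ∈ M := by
  have hroot : ∀ y : ℕ, (M.map fun ζ : ℕ => (y : ℤ) - ζ).prod = 0 ↔ y ∈ M := by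
    intro y
    rw [Multiset.prod_eq_zero_iff, Multiset.mem_map]
    constructor
    · rintro ⟨ζ, hζ, h0⟩
      rwa [show y = ζ by omega]
    · exact fun hy => ⟨y, hy, sub_self _⟩
  obtain ⟨g, hg⟩ := exists_prod_sub_eq_sum_choose M hM
  have h1 := h.sum_eq_sum_powersetCard htk hkv A₀ g
  simp only [← hg] at h1
  rw [Finset.sum_eq_zero fun A hA => by rw [(hroot _).2 (hz A hA), Int.cast_zero], eq_comm,
    mul_eq_zero, or_iff_right hρ.ne', Finset.sum_eq_zero_iff_of_nonneg fun A _ => by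
      exact_mod_cast hnn _] at h1
  obtain ⟨A₁, hA₁, hA₁c⟩ := Finset.exists_subset_card_eq (s := A₀) (n := k - z) (by omega)
  obtain ⟨A₂, hA₂, hA₂c⟩ := Finset.exists_subset_card_eq (s := A₀ᶜ) (n := z)
    (by rw [Finset.card_compl]; omega)
  have hd : Disjoint A₀ A₂ := Finset.disjoint_right.2 fun x hx => by simpa using hA₂ hx
  have h2 := h1 (A₁ ∪ A₂) (Finset.mem_powersetCard.2 ⟨Finset.subset_univ _, by
    rw [Finset.card_union_of_disjoint (hd.mono_left hA₁)]; omega⟩)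
  have h3 : A₀ \ (A₁ ∪ A₂) = A₀ \ A₁ := by
    rw [Finset.sdiff_union_distrib, Finset.sdiff_eq_self_of_disjoint hd]
    exact Finset.inter_eq_left.2 Finset.sdiff_subset
  rw [h3, Finset.card_sdiff_of_subset hA₁, Int.cast_eq_zero, hroot] at h2
  rwa [show A₀.card - A₁.card = z by omega] at h2

theorem card_differenceSet_le (h : IsRegularFamily (2 * s) k ρ B) (hρ : 0 < ρ) (hsk : s ≤ k)
    (hkv : k + s ≤ Fintype.card V) (hcard : B.card = (Fintype.card V).choose s)
    {A₀ : Finset V} (hA₀ : A₀ ∈ B) : (differenceSet B A₀).card ≤ s := by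
  by_contra hlt
  have h1 := eq_zero_of_sum_mul_choose_eq_zero (m := s + 1) (by omega)
    (fun z hz => h.sum_mul_choose_eq_zero_of_mem_differenceSet hρ hsk hkv hcard hA₀ hz)
    s (Nat.lt_succ_self s)
  have h2 : (0 : ℚ) < (Fintype.card V - s - s).choose (k - s) := by
    exact_mod_cast Nat.choose_pos (by omega)
  have h3 := (mul_pos hρ h2).ne'
  simp [hρ.ne'] at h1
  exact h2.ne' (by exact_mod_cast h1)

theorem card_sdiff_mem_of_mem {A₀ : Finset V} {M : Multiset ℕ} (h0 : 0 ∈ M)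
    (hM : ∀ z ∈ differenceSet B A₀, z ∈ M) : ∀ A ∈ B, (A₀ \ A).card ∈ M := by
  intro A hA
  by_cases hAA : A = A₀
  · simpa [hAA] using h0
  · exact hM _ (Finset.mem_image_of_mem _ (Finset.mem_erase.2 ⟨hAA, hA⟩))

theorem prod_sub_add_self_nonneg (Z : Finset ℕ) (z : ℤ) :
    0 ≤ ((Z.val + Z.val).map fun ζ : ℕ => z - ζ).prod := by
  rw [Multiset.map_add, Multiset.prod_add]
  exact mul_self_nonneg _

/-- If the differences of the block `A₀` are contained in a multiset of size at most `2 s` that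
contains zero and defines a nonnegative polynomial, there are too many differences of `k`-sets
for it. -/
theorem false_of_prod_nonneg (h : IsRegularFamily (2 * s) k ρ B) (hρ : 0 < ρ) (hs : 0 < s)
    (hsk : 2 * s ≤ k) (hkv : k + s + 1 ≤ Fintype.card V) {A₀ : Finset V} (hA₀ : A₀ ∈ B)
    (hcard : (differenceSet B A₀).card ≤ s)
    {M : Multiset ℕ} (hM : M.card ≤ 2 * s)
    (hnn : ∀ z : ℕ, 0 ≤ (M.map fun ζ : ℕ => (z : ℤ) - ζ).prod)
    (h0 : 0 ∈ M) (hmem : ∀ z, z ∈ M → z = 0 ∨ z ∈ differenceSet B A₀)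
    (hmem' : ∀ z ∈ differenceSet B A₀, z ∈ M) : False := by
  have h1 : Finset.range (s + 2) ⊆ insert 0 (differenceSet B A₀) := by
    intro z hz
    rw [Finset.mem_range] at hz
    rw [Finset.mem_insert]
    exact hmem z (h.mem_of_prod_nonneg hρ hsk (by omega) (h.card_block A₀ hA₀) hM hnn
      (card_sdiff_mem_of_mem h0 hmem') (by omega) (by omega))
  have h2 := Finset.card_le_card h1
  have h3 := Finset.card_insert_le 0 (differenceSet B A₀)
  rw [Finset.card_range] at h2
  omega

theorem card_differenceSet (h : IsRegularFamily (2 * s) k ρ B) (hρ : 0 < ρ) (hs : 0 < s)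
    (hsk : 2 * s ≤ k) (hkv : k + s + 1 ≤ Fintype.card V)
    (hcard : B.card = (Fintype.card V).choose s) {A₀ : Finset V} (hA₀ : A₀ ∈ B) :
    (differenceSet B A₀).card = s := by
  have hle := h.card_differenceSet_le hρ (by omega) (by omega) hcard hA₀
  by_contra hne
  refine h.false_of_prod_nonneg hρ hs hsk hkv hA₀ hle
    (M := 0 ::ₘ ((differenceSet B A₀).val + (differenceSet B A₀).val)) ?_ (fun z => ?_)
    (by simp) (by simp) (by simp +contextual)
  · rw [Multiset.card_cons, Multiset.card_add, Finset.card_val]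
    omega
  · rw [Multiset.map_cons, Multiset.prod_cons]
    exact mul_nonneg (by simp) (prod_sub_add_self_nonneg _ _)

theorem succ_notMem_differenceSet (h : IsRegularFamily (2 * s) k ρ B) (hρ : 0 < ρ) (hs : 0 < s)
    (hsk : 2 * s ≤ k) (hkv : k + s + 1 ≤ Fintype.card V)
    (hcard : B.card = (Fintype.card V).choose s) {A₀ : Finset V} (hA₀ : A₀ ∈ B) {z : ℕ}
    (hz : z ∈ differenceSet B A₀) : z + 1 ∉ differenceSet B A₀ := by
  intro hz1
  have hle := h.card_differenceSet_le hρ (by omega) (by omega) hcard hA₀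
  set Z := ((differenceSet B A₀).erase z).erase (z + 1) with hZ
  have hZc : Z.card + 2 = (differenceSet B A₀).card := by
    have h1 := Finset.card_erase_add_one hz
    have h2 := Finset.card_erase_add_one (s := (differenceSet B A₀).erase z) (a := z + 1)
      (Finset.mem_erase.2 ⟨by omega, hz1⟩)
    rw [← hZ] at h2
    omega
  refine h.false_of_prod_nonneg hρ hs hsk hkv hA₀ hle
    (M := 0 ::ₘ z ::ₘ (z + 1) ::ₘ (Z.val + Z.val)) ?_ (fun y => ?_) (by simp) ?_ ?_
  · simp only [Multiset.card_cons, Multiset.card_add, Finset.card_val]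
    omega
  · simp only [Multiset.map_cons, Multiset.prod_cons]
    rw [← mul_assoc, ← mul_assoc]
    refine mul_nonneg ?_ (prod_sub_add_self_nonneg _ _)
    rw [mul_assoc]
    refine mul_nonneg (by simp) ?_
    rcases Nat.lt_or_ge z y with hy | hy
    · exact mul_nonneg (by omega) (by push_cast; omega)
    · exact mul_nonneg_of_nonpos_of_nonpos (by omega) (by push_cast; omega)
  · intro y hy
    simp only [Multiset.mem_cons, Multiset.mem_add, Finset.mem_val, or_self, hZ,
      Finset.mem_erase] at hy
    rcases hy with rfl | rfl | rfl | hy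
    · exact Or.inl rfl
    · exact Or.inr hz
    · exact Or.inr hz1
    · exact Or.inr hy.2.2
  · intro y hy
    simp only [Multiset.mem_cons, Multiset.mem_add, Finset.mem_val, or_self, hZ,
      Finset.mem_erase]
    tauto

/-- The `s` block differences lie in `[1, card V - k]` and no two of them are consecutive. -/
theorem two_mul_le (h : IsRegularFamily (2 * s) k ρ B) (hρ : 0 < ρ) (hs : 0 < s)
    (hsk : 2 * s ≤ k) (hkv : k + s + 1 ≤ Fintype.card V)
    (hcard : B.card = (Fintype.card V).choose s) {A₀ : Finset V} (hA₀ : A₀ ∈ B) :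
    2 * s ≤ Fintype.card V - k + 1 := by
  have hc := h.card_differenceSet hρ hs hsk hkv hcard hA₀
  set Z := differenceSet B A₀ with hZ
  have hd : Disjoint Z (Z.map (addRightEmbedding 1)) := by
    rw [Finset.disjoint_right]
    intro y hy
    obtain ⟨z, hz, rfl⟩ := Finset.mem_map.1 hy
    exact h.succ_notMem_differenceSet hρ hs hsk hkv hcard hA₀ hz
  have hsub : Z ∪ Z.map (addRightEmbedding 1) ⊆ Finset.Icc 1 (Fintype.card V - k + 1) := by
    intro y hy
    rw [Finset.mem_Icc]
    rcases Finset.mem_union.1 hy with hy | hy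
    · have h1 := pos_of_mem_differenceSet h.card_block hA₀ hy
      have h2 := le_of_mem_differenceSet h.card_block hy
      omega
    · obtain ⟨z, hz, rfl⟩ := Finset.mem_map.1 hy
      have h2 := le_of_mem_differenceSet h.card_block hz
      rw [addRightEmbedding_apply]
      omega
  have h3 := Finset.card_le_card hsub
  rw [Finset.card_union_of_disjoint hd, Finset.card_map, Nat.card_Icc] at h3
  omega

end IsRegularFamily

/-! ### Divisibility conditions for tight designs -/

namespace IsRegularFamily

variable {V : Type*} [Fintype V] [DecidableEq V] {s k : ℕ} {ρ : ℚ} {B : Finset (Finset V)}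

/-- The annihilator polynomial is a multiple of the monic polynomial whose roots are the `s` block
differences, which has integer coefficients in the basis of falling factorials. -/
theorem exists_int_eq (h : IsRegularFamily (2 * s) k ρ B) (hρ : 0 < ρ) (hs : 0 < s)
    (hsk : 2 * s ≤ k) (hkv : k + s + 1 ≤ Fintype.card V)
    (hcard : B.card = (Fintype.card V).choose s) {A₀ : Finset V} (hA₀ : A₀ ∈ B) {a : ℕ}
    (ha : a < s) :
    ∃ e : ℤ, ((-1) ^ (s - a) * (k - s + (s - a)).choose (s - a) * s ! *
      (Fintype.card V - s - s).choose (k - s) : ℚ) =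
        e * (a ! * (Fintype.card V - s - a).choose (k - s)) := by
  have hc := h.card_differenceSet hρ hs hsk hkv hcard hA₀
  set lam : ℕ → ℚ := fun a => ρ * (Fintype.card V - s - a).choose (k - s) with hlam
  have hlam0 : ∀ a ≤ s, lam a ≠ 0 := by
    intro a ha
    have : (0 : ℚ) < (Fintype.card V - s - a).choose (k - s) := by
      exact_mod_cast Nat.choose_pos (by omega)
    exact (mul_pos hρ this).ne'
  set f : ℕ → ℚ := fun a => (-1) ^ (s - a) * (k - s + (s - a)).choose (s - a) / lam a with hf
  obtain ⟨e, he1, he⟩ := exists_prod_sub_eq_sum_descFactorial (differenceSet B A₀).val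
  rw [Finset.card_val, hc] at he1 he
  have hfs : f s = 1 / lam s := by simp [hf]
  have hzero := eq_zero_of_sum_mul_choose_eq_zero (m := s) (Z := differenceSet B A₀)
    (g := fun a => f a * (s !) - f s * (e a * a !)) hc.ge (fun z hz => by
      have h1 := h.sum_mul_choose_eq_zero_of_mem_differenceSet hρ (by omega) (by omega) hcard hA₀ hz
      change ∑ a ∈ Finset.range (s + 1), f a * (z.choose a : ℚ) = 0 at h1
      have h2 := he z
      rw [Multiset.prod_eq_zero (Multiset.mem_map.2 ⟨z, hz, sub_self _⟩)] at h2
      have h3 : (0 : ℚ) = ∑ a ∈ Finset.range (s + 1), e a * a ! * (z.choose a : ℚ) := by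
        have h4 : ((0 : ℤ) : ℚ) = ((∑ a ∈ Finset.range (s + 1), e a * z.descFactorial a : ℤ) : ℚ) :=
          congrArg _ h2
        push_cast at h4
        rw [h4]
        refine Finset.sum_congr rfl fun a _ => ?_
        rw [Nat.descFactorial_eq_factorial_mul_choose]
        push_cast
        ring
      have h5 : ∑ a ∈ Finset.range (s + 1),
          (f a * (s !) - f s * (e a * a !)) * (z.choose a : ℚ) = 0 := by
        calc ∑ a ∈ Finset.range (s + 1), (f a * (s !) - f s * (e a * a !)) * (z.choose a : ℚ)
            = s ! * ∑ a ∈ Finset.range (s + 1), f a * (z.choose a : ℚ) -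
              f s * ∑ a ∈ Finset.range (s + 1), e a * a ! * (z.choose a : ℚ) := by
              rw [Finset.mul_sum, Finset.mul_sum, ← Finset.sum_sub_distrib]
              exact Finset.sum_congr rfl fun a _ => by ring
          _ = 0 := by rw [h1, ← h3]; ring
      rw [Finset.sum_range_succ, he1, Int.cast_one, one_mul, sub_self, zero_mul, add_zero] at h5
      exact h5) a ha
  refine ⟨e a, ?_⟩
  simp only [hfs, sub_eq_zero] at hzero
  simp only [hf] at hzero
  have h0 := hlam0 a ha.le
  have h1 := hlam0 s le_rfl
  field_simp at hzero
  simp only [hlam] at hzero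
  refine mul_left_cancel₀ hρ.ne' ?_
  linear_combination hzero

theorem exists_nat_mul_choose_eq (h : IsRegularFamily (2 * s) k ρ B) (hsk : 2 * s ≤ k)
    (hkv : k ≤ Fintype.card V) (hcard : B.card = (Fintype.card V).choose s) {i j : ℕ}
    (hij : i + j ≤ 2 * s) :
    ∃ N : ℕ, N * (Fintype.card V).choose k =
      (Fintype.card V).choose s * (Fintype.card V - i - j).choose (k - i) := by
  obtain ⟨I, -, hI⟩ := Finset.exists_subset_card_eq (s := (Finset.univ : Finset V)) (n := i)
    (by rw [Finset.card_univ]; omega)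
  obtain ⟨J, hJI, hJ⟩ := Finset.exists_subset_card_eq (s := Iᶜ) (n := j)
    (by rw [Finset.card_compl]; omega)
  have hd : Disjoint I J := Finset.disjoint_right.2 fun x hx => by simpa using hJI hx
  have h1 := h.count I J hd (by omega)
  have h2 := h.count ∅ ∅ (Finset.disjoint_empty_left _) (by simp)
  simp only [blockCount, Finset.empty_subset, Finset.disjoint_empty_left, and_self,
    Finset.filter_true, Finset.card_empty, Nat.sub_zero, hcard] at h2
  refine ⟨blockCount B I J, ?_⟩
  rw [hI, hJ] at h1
  have h3 : (blockCount B I J : ℚ) * (Fintype.card V).choose k =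
      (Fintype.card V).choose s * (Fintype.card V - i - j).choose (k - i) := by
    rw [h1, h2]
    ring
  exact_mod_cast h3

/-- The divisibility conditions satisfied by the parameters of a tight design. -/
theorem isAdmissible (h : IsRegularFamily (2 * s) k ρ B) (hρ : 0 < ρ) (hs : 0 < s)
    (hsk : 2 * s ≤ k) (hkv : k + s + 1 ≤ Fintype.card V)
    (hcard : B.card = (Fintype.card V).choose s) {A₀ : Finset V} (hA₀ : A₀ ∈ B) :
    IsAdmissible s (k - s) (Fintype.card V - k - s) := by
  obtain ⟨K, rfl⟩ : ∃ K, k = K + s := ⟨k - s, by omega⟩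
  obtain ⟨L, hL⟩ : ∃ L, Fintype.card V = K + s + s + L := ⟨Fintype.card V - (K + s + s), by omega⟩
  rw [Nat.add_sub_cancel, show Fintype.card V - (K + s) - s = L by omega]
  refine ⟨by omega, by omega, fun j hj => ?_, fun j hj t ht htj => ?_⟩
  · obtain ⟨a, rfl⟩ : ∃ a, s = a + (j + 1) := ⟨s - (j + 1), by omega⟩
    obtain ⟨e, he⟩ := h.exists_int_eq hρ hs hsk hkv hcard hA₀ (a := a) (by omega)
    set m := j + 1 with hm
    rw [hL, show a + m - a = m by omega, Nat.add_sub_cancel,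
      show K + (a + m) + (a + m) + L - (a + m) - (a + m) = K + L by omega,
      show K + (a + m) + (a + m) + L - (a + m) - a = K + (L + m) by omega] at he
    have he' : ((-1) ^ m * (K + m).choose m * (a + m)! * (K + L).choose K : ℤ) =
        e * (a ! * (K + (L + m)).choose K) := by exact_mod_cast he
    rw [Nat.choose_symm_add (a := K) (b := L), Nat.choose_symm_add (a := K) (b := L + m)] at he'
    have q1 := congrArg (Nat.cast (R := ℤ)) (Nat.ascFactorial_eq_factorial_mul_choose K m)
    have c2 := congrArg (Nat.cast (R := ℤ)) (Nat.add_choose_mul_factorial_mul_factorial K L)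
    have c3 := congrArg (Nat.cast (R := ℤ)) (Nat.add_choose_mul_factorial_mul_factorial K (L + m))
    have c4 := congrArg (Nat.cast (R := ℤ)) (Nat.add_choose_mul_factorial_mul_factorial a m)
    have p2 := congrArg (Nat.cast (R := ℤ)) (Nat.factorial_mul_ascFactorial L m)
    have p3 := congrArg (Nat.cast (R := ℤ)) (Nat.factorial_mul_ascFactorial (K + L) m)
    rw [← add_assoc K L m] at c3 he'
    rw [Nat.cast_mul] at q1 p2 p3
    rw [Nat.cast_mul, Nat.cast_mul] at c2 c3 c4
    have hx : (-1 : ℤ) ^ m * (-1) ^ m = 1 := by rw [← mul_pow]; simp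
    have h0 : ((a ! : ℕ) : ℤ) * (((K + L)! : ℕ) : ℤ) ≠ 0 := by positivity
    rw [← Int.natCast_dvd_natCast]
    refine ⟨(-1) ^ m * e, mul_left_cancel₀ h0 ?_⟩
    rw [Nat.cast_mul, Nat.cast_mul]
    generalize (-1 : ℤ) ^ m = x at he' hx ⊢
    generalize ((K + L + 1).ascFactorial m : ℤ) = P3 at p3 ⊢
    generalize ((L + 1).ascFactorial m : ℤ) = P2 at p2 ⊢
    generalize ((K + 1).ascFactorial m : ℤ) = P1 at q1 ⊢
    generalize ((K + m).choose m : ℤ) = C1 at he' q1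
    generalize ((K + L).choose L : ℤ) = C2 at he' c2
    generalize ((K + L + m).choose (L + m) : ℤ) = C3 at he' c3
    generalize ((a + m).choose m : ℤ) = C4 at c4 ⊢
    linear_combination -((a ! : ℤ) * x * e * p3 - (a ! : ℤ) * x * e * c3 -
      x * (K ! : ℤ) * ((L + m)! : ℤ) * he' +
      C1 * ((a + m)! : ℤ) * C2 * (K ! : ℤ) * ((L + m)! : ℤ) * hx -
      C1 * ((a + m)! : ℤ) * C2 * (K ! : ℤ) * p2 + C1 * ((a + m)! : ℤ) * P2 * c2 -
      C1 * ((K + L)! : ℤ) * P2 * c4 - ((K + L)! : ℤ) * C4 * (a ! : ℤ) * P2 * q1)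
  · obtain ⟨N, hN⟩ := h.exists_nat_mul_choose_eq hsk (by omega) hcard
      (i := s + 1 - t) (j := s + t - 1 - j) (by omega)
    obtain ⟨t, rfl⟩ : ∃ t', t = t' + 1 := ⟨t - 1, by omega⟩
    obtain ⟨w, rfl⟩ : ∃ w, j = t + w := ⟨j - t, by omega⟩
    obtain ⟨u, rfl⟩ : ∃ u, s = t + w + u := ⟨s - (t + w), by omega⟩
    rw [hL] at hN
    rw [show t + w + u + 1 - (t + 1) = w + u by omega,
      show t + w + u + (t + 1) - 1 - (t + w) = t + u by omega] at hN ⊢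
    rw [show K + (t + w + u) + (t + w + u) + L - (w + u) - (t + u) = L + w + (K + t) by omega,
      show K + (t + w + u) - (w + u) = K + t by omega] at hN
    rw [show L + (t + w + 2 - (t + 1)) = L + w + 1 by omega,
      show t + w + u - (t + w) = u by omega, ← add_assoc K t 1, add_right_comm (K + L) 1 (t + w)]
    have c1 := Nat.add_choose_mul_factorial_mul_factorial (L + (t + w + u)) (K + (t + w + u))
    have c2 := Nat.add_choose_mul_factorial_mul_factorial (K + L + (t + w + u)) (t + w + u)
    have c3 := Nat.add_choose_mul_factorial_mul_factorial (L + w) (K + t)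
    have p1 := Nat.factorial_mul_ascFactorial (K + t) (w + u)
    have p2 := Nat.factorial_mul_ascFactorial (L + w) (t + u)
    have p3 := Nat.factorial_mul_ascFactorial (K + L + (t + w)) u
    rw [show L + (t + w + u) + (K + (t + w + u)) = K + (t + w + u) + (t + w + u) + L by ring] at c1
    rw [show K + L + (t + w + u) + (t + w + u) = K + (t + w + u) + (t + w + u) + L by ring] at c2
    rw [show L + w + (K + t) = K + L + (t + w) by ring] at c3 hN
    rw [show K + t + (w + u) = K + (t + w + u) by ring] at p1
    rw [show L + w + (t + u) = L + (t + w + u) by ring] at p2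
    rw [show K + L + (t + w) + u = K + L + (t + w + u) by ring] at p3
    rw [← p1, ← p2] at c1
    rw [← p3] at c2
    refine ⟨N, ?_⟩
    generalize (K + t + 1).ascFactorial (w + u) = P1 at c1 ⊢
    generalize (L + w + 1).ascFactorial (t + u) = P2 at c1 ⊢
    generalize (K + L + (t + w) + 1).ascFactorial u = P3 at c2 ⊢
    have hv0 := Nat.factorial_pos (K + (t + w + u) + (t + w + u) + L)
    have h0 := Nat.factorial_pos (K + L + (t + w))
    generalize (K + (t + w + u) + (t + w + u) + L)! = v' at c1 c2 hv0
    generalize (K + (t + w + u) + (t + w + u) + L).choose (K + (t + w + u)) = C1 at c1 hN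
    generalize (K + (t + w + u) + (t + w + u) + L).choose (t + w + u) = C2 at c2 hN
    refine Nat.eq_of_mul_eq_mul_left (Nat.mul_pos hv0 h0) ?_
    calc v' * (K + L + (t + w))! * (P1 * P2)
        = C2 * (K + L + (t + w)).choose (K + t) *
          ((K + L + (t + w))! * P3 * (t + w + u)! * (L + w)! * (K + t)! * P1 * P2) := by
          rw [← c2]
          nth_rewrite 2 [← c3]
          ring
      _ = v' * (K + L + (t + w))! * ((t + w + u)! * P3 * N) := by
          rw [← hN, ← c1]
          ring

end IsRegularFamily

/-! ### The bound for tight designs -/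

/-- A `k`-set is the only `k`-set that avoids its complement, so if complements of blocks have at
most `t` points, then every `k`-set is a block. -/
theorem IsRegularFamily.eq_powersetCard {V : Type*} [Fintype V] [DecidableEq V] {t k : ℕ} {ρ : ℚ}
    {B : Finset (Finset V)} (h : IsRegularFamily t k ρ B) (hρ : 0 < ρ)
    (hkv : k ≤ Fintype.card V) (hvt : Fintype.card V ≤ k + t) :
    B = Finset.univ.powersetCard k := by
  refine Finset.Subset.antisymm
    (fun A hA => Finset.mem_powersetCard.2 ⟨Finset.subset_univ _, h.card_block A hA⟩) ?_
  intro A hA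
  have hAk := (Finset.mem_powersetCard.1 hA).2
  have hc : Aᶜ.card = Fintype.card V - k := by rw [Finset.card_compl, hAk]
  have h1 := h.count ∅ Aᶜ (Finset.disjoint_empty_left _) (by rw [hc, Finset.card_empty]; omega)
  rw [hc, Finset.card_empty, Nat.sub_zero, Nat.sub_zero, Nat.sub_sub_self hkv, Nat.choose_self,
    Nat.cast_one, mul_one] at h1
  have h2 : 0 < blockCount B ∅ Aᶜ := by exact_mod_cast h1 ▸ hρ
  obtain ⟨A', hA'⟩ := Finset.card_pos.1 h2
  rw [Finset.mem_filter] at hA'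
  have hsub : A' ⊆ A := by
    rw [← Finset.compl_subset_compl]
    exact fun x hx => Finset.mem_compl.2 (Finset.disjoint_left.1 hA'.2.2 hx)
  rw [← Finset.eq_of_subset_of_card_le hsub (by rw [hAk, h.card_block A' hA'.1])]
  exact hA'.1

theorem IsNontrivialTightDesign.isAdmissible {V : Type*} [Fintype V] [DecidableEq V]
    {s v k l : ℕ} {B : Finset (Finset V)} (h : IsNontrivialTightDesign s v k l B)
    (hv : 2 * s ≤ v) :
    2 * s ≤ k ∧ k + s < v ∧ IsAdmissible s (k - s) (v - k - s) ∧ 2 * s ≤ v - k + 1 := by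
  obtain ⟨hD, hnt, htight⟩ := h
  have hcv := hD.card_points
  have hs : 0 < s := by have := hD.t_pos; omega
  obtain ⟨T, -, hT⟩ := Finset.exists_subset_card_eq (s := (Finset.univ : Finset V)) (n := 2 * s)
    (by rw [Finset.card_univ]; omega)
  have hTl := hD.card_cover T hT
  obtain ⟨A₀, hA₀⟩ := Finset.card_pos.1 (hTl ▸ hD.l_pos)
  rw [Finset.mem_filter] at hA₀
  have hsk : 2 * s ≤ k := by
    rw [← hD.card_block A₀ hA₀.1, ← hT]
    exact Finset.card_le_card hA₀.2
  have hkv : k ≤ v := by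
    rw [← hD.card_block A₀ hA₀.1, ← hcv]
    exact Finset.card_le_univ _
  have hR := hD.isRegularFamily hsk hkv
  have hρ : (0 : ℚ) < (l : ℚ) / (v - 2 * s).choose (k - 2 * s) :=
    div_pos (by exact_mod_cast hD.l_pos) (by exact_mod_cast Nat.choose_pos (by omega))
  have hks : k + s < v := by
    by_contra hlt
    exact hnt (hR.eq_powersetCard hρ (by omega) (by omega))
  rw [← hcv] at htight hks ⊢
  exact ⟨hsk, hks, hR.isAdmissible hρ hs hsk (by omega) htight hA₀.1,
    hR.two_mul_le hρ hs hsk (by omega) htight hA₀.1⟩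

theorem theorem4p3 (s r : ℕ) (hr : Even r) (hr6 : 6 ≤ r) (hrs : r ≤ s)
    (b : ℝ) (hb : b ≤ (s : ℝ)) (hpsi : 0 < psi r b)
    (v k l : ℕ) {V : Type*} [Fintype V] [DecidableEq V] (B : Finset (Finset V))
    (hB : IsNontrivialTightDesign s v k l B) :
    (v : ℝ) - 2 * (s : ℝ) + 1 ≤ Real.exp (kappa s r b / psi r b) := by
  rcases Nat.lt_or_ge v (2 * s) with hv | hv
  · have h1 : (v : ℝ) + 1 ≤ 2 * s := by exact_mod_cast hv
    have h2 := Real.exp_pos (kappa s r b / psi r b)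
    linarith
  obtain ⟨hsk, hks, hadm, hgap⟩ := hB.isAdmissible hv
  obtain ⟨I, rfl⟩ : ∃ I, r = 2 * I + 2 := by
    obtain ⟨c, rfl⟩ := hr
    exact ⟨c - 1, by omega⟩
  have hmain := hadm.psi_mul_log_le (I := I) (by omega) hrs (by omega) hb
  have hn : (v : ℝ) - 2 * (s : ℝ) + 1 = ((k - s + (v - k - s) + 1 : ℕ) : ℝ) := by
    have h1 : k - s + (v - k - s) + 1 + 2 * s = v + 1 := by omega
    have h2 : ((k - s + (v - k - s) + 1 : ℕ) : ℝ) + 2 * s = v + 1 := by exact_mod_cast h1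
    linarith
  rw [hn, ← Real.log_le_iff_le_exp (by exact_mod_cast Nat.succ_pos _), le_div_iff₀ hpsi, mul_comm]
  exact hmain
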